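/- An oracle is a family $A=(A_m)_m$ of Boolean functions $A_m:\{0,1\}^m\to\{0,1\}$. Its multilinear extension $\widetilde A$ is the collection of the functions $\widetilde A_{m,\mathbb F}:\mathbb F^m\to\mathbb F$, for all $m$ and all finite fields $\mathbb F$, where $\widetilde A_{m,\mathbb F}$ is given by the unique multilinear polynomial over $\mathbb F$ that agrees with $A_m$ on $\{0,1\}^m$; a machine with access to $\widetilde A$ may query $\widetilde A_{m,\mathbb F}$ for any $m,\mathbb F$ of its choice, and such a query takes $O(m\log|\mathbb F|)$ time. A promise problem $(\Pi_{\rm yes},\Pi_{\rm no})$ is in $\mathrm{pr}\text{-}\mathsf{PostBPE}^{\widetilde A}$ if there are two deterministic machines $M,N$ with access to $\widetilde A$ that run in time $2^{O(n)}$ on inputs $x\in\{0,1\}^n$ and (common) randomness $r$ of length $2^{O(n)}$, such that for all $x\in\Pi_{\rm yes}\cup\Pi_{\rm no}$ we have $\Pr_r[N(x,r)=1]>0$, and $\Pr_r[M(x,r)=1\mid N(x,r)=1]$ is at least $2/3$ if $x\in\Pi_{\rm yes}$ and at most $1/3$ if $x\in\Pi_{\rm no}$. It is in $\mathrm{pr}\text{-}\mathsf{MA_E}^{\widetilde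 A}$ if there is a deterministic machine $V$ with access to $\widetilde A$ that runs in time $2^{O(n)}$ on inputs $x\in\{0,1\}^n$, proofs $\pi$ and randomness $r$ of length $2^{O(n)}$, such that for $x\in\Pi_{\rm yes}$ some $\pi$ has $\Pr_r[V(x,\pi,r)=1]\ge 2/3$, and for $x\in\Pi_{\rm no}$ every $\pi$ has $\Pr_r[V(x,\pi,r)=1]\le 1/3$. It is in $\text{i.o.-}\mathsf{SIZE}^{A}[O(n)]$ if there is a constant $c$ such that, for infinitely many $n$, some $A$-oracle circuit of size at most $cn$ accepts all $x\in\Pi_{\rm yes}\cap\{0,1\}^n$ and rejects all $x\in\Pi_{\rm no}\cap\{0,1\}^n$. **Theorem.** There is an oracle $A_1$ with multilinear extension $\widetilde{A_1}$ such that $$\mathrm{pr}\text{-}\mathsf{PostBPE}^{\widetilde{A_1}}\subseteq \text{i.o.-}\mathsf{SIZE}^{A_1}[O(n)].$$ In particular, also $$\mathrm{pr}\text{-}\mathsf{MA_E}^{\widetilde{A_1}}\subseteq \text{i.o.-}\mathsf{SIZE}^{A_1}[O(n)].$$ That is, the almost-everywhere circuit lower bounds $\mathrm{pr}\text{-}\mathsf{PostBPE}\not\subseteq\text{i.o.-}\mathsf{SIZE}[O(n)]$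 and $\mathrm{pr}\text{-}\mathsf{MA_E}\not\subseteq\text{i.o.-}\mathsf{SIZE}[O(n)]$ do not algebrize (where $\mathcal C\not\subseteq\mathcal D$ is said not to algebrize if $\mathcal C^{\widetilde A}\subseteq\mathcal D^{A}$ for some oracle $A$ and some low-degree extension $\widetilde A$ of $A$). -/

import Mathlib

open Filter

namespace Algebrization

/-! ### Oracles and their multilinear extensions -/

/-- An oracle: one Boolean function on `{0,1}^m` for every `m`. -/
abbrev Oracle : Type := (m : ℕ) → (Fin m → Bool) → Bool

/-- The multilinear extension of `a : {0,1}^m → {0,1}` over `R`, as a polynomial in `m` variables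
(each variable is `X i`, and the summand of `b` is the indicator polynomial of the point `b`). -/
noncomputable def mlPoly (R : Type*) [CommRing R] {m : ℕ} (a : (Fin m → Bool) → Bool) :
    MvPolynomial (Fin m) R :=
  ∑ b : Fin m → Bool,
    if a b then ∏ i, (if b i then MvPolynomial.X i else 1 - MvPolynomial.X i) else 0

/-- The multilinear extension of `a` over `R`, as a function `R^m → R`. -/
noncomputable def mlExt (R : Type*) [CommRing R] {m : ℕ} (a : (Fin m → Bool) → Bool)
    (x : Fin m → R) : R :=
  MvPolynomial.eval x (mlPoly R a)

/-- `mlPoly` is multilinear. -/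
theorem degreeOf_mlPoly_le (R : Type*) [CommRing R] {m : ℕ} (a : (Fin m → Bool) → Bool)
    (i : Fin m) : (mlPoly R a).degreeOf i ≤ 1 := by
  classical
  rcases subsingleton_or_nontrivial R with hR | hR
  · rw [Subsingleton.elim (mlPoly R a) 0]; simp
  refine (MvPolynomial.degreeOf_sum_le i _ _).trans (Finset.sup_le fun b _ => ?_)
  split_ifs
  · refine (MvPolynomial.degreeOf_prod_le i _ _).trans ?_
    have h : ∀ j ∈ Finset.univ, MvPolynomial.degreeOf i (if b j then (MvPolynomial.X j :
        MvPolynomial (Fin m) R) else 1 - MvPolynomial.X j) ≤ if j = i then 1 else 0 := by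
      intro j _
      have hX : MvPolynomial.degreeOf i (MvPolynomial.X j : MvPolynomial (Fin m) R)
          ≤ if j = i then 1 else 0 := by
        rw [MvPolynomial.degreeOf_X]; simp [eq_comm]
      split_ifs at hX ⊢ <;> try exact hX
      all_goals
        refine (MvPolynomial.degreeOf_sub_le i _ _).trans ?_
        simpa using hX
    refine (Finset.sum_le_sum h).trans ?_
    simp
  · simp

/-- The multilinear extension agrees with `a` on the Boolean cube. -/
theorem mlExt_bool (R : Type*) [CommRing R] {m : ℕ} (a : (Fin m → Bool) → Bool)
    (b : Fin m → Bool) :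
    mlExt R a (fun i => if b i then 1 else 0) = if a b then 1 else 0 := by
  classical
  unfold mlExt mlPoly
  rw [map_sum, Finset.sum_eq_single b]
  · split_ifs
    · rw [map_prod]
      refine Finset.prod_eq_one fun i _ => ?_
      cases h : b i <;> simp [h]
    · simp
  · intro c _ hc
    split_ifs
    · rw [map_prod]
      obtain ⟨i, hi⟩ := Function.ne_iff.mp hc
      refine Finset.prod_eq_zero (Finset.mem_univ i) ?_
      cases h : b i <;> cases h' : c i <;> simp_all
    · simp
  · simp

/-- Over a field, `mlPoly` is the only multilinear polynomial that agrees with `a`. -/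
theorem mlPoly_unique (F : Type*) [Field F] {m : ℕ} (a : (Fin m → Bool) → Bool)
    (P : MvPolynomial (Fin m) F) (hdeg : ∀ i, P.degreeOf i ≤ 1)
    (hP : ∀ b : Fin m → Bool,
      MvPolynomial.eval (fun i => if b i then (1 : F) else 0) P = if a b then 1 else 0) :
    P = mlPoly F a := by
  classical
  rw [← sub_eq_zero]
  refine MvPolynomial.eq_zero_of_eval_zero_at_prod_finset _ (fun _ => ({0, 1} : Finset F)) ?_ ?_
  · intro i
    rw [Finset.card_pair zero_ne_one]
    refine lt_of_le_of_lt (MvPolynomial.degreeOf_sub_le i _ _) ?_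
    exact Nat.lt_succ_of_le (max_le (hdeg i) (degreeOf_mlPoly_le F a i))
  · intro x hx
    have hx' : x = fun i => if (decide (x i = 1)) then (1 : F) else 0 := by
      funext i
      have := hx i
      simp only [Finset.mem_insert, Finset.mem_singleton] at this
      rcases this with h | h <;> simp [h]
    rw [hx', map_sub, hP, sub_eq_zero]
    exact (mlExt_bool F a _).symm

/-! ### Encoding of queries to the multilinear extension

A finite field is presented as `ZMod p [X] / (f)` with `p` prime and `f` monic irreducible of
degree `k`; every finite field is isomorphic to one of these.  Numbers are written in binary, least
significant bit first.  A query is a word `p # f # x₁ # … # xₘ`, where, for some width `ℓ`, `p` is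
written with `ℓ` bits, and `f` and the field elements `xᵢ` are lists of `k` coefficients with `ℓ`
bits each (`f` without its leading coefficient).  If `ℓ` is the binary length of `p`, the query has
length `Θ(m log |F|)`. -/

/-- The number with the given binary digits. -/
def bitsToNat (w : List Bool) : ℕ := Nat.ofDigits 2 (w.map Bool.toNat)

/-- The `i`-th of the `ℓ`-bit numbers that are concatenated in `w`. -/
def coeffAt (ℓ : ℕ) (w : List Bool) (i : ℕ) : ℕ := bitsToNat ((w.drop (i * ℓ)).take ℓ)

/-- The polynomial of degree less than `k` whose coefficients are listed in `w`. -/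
noncomputable def decodePoly (p k ℓ : ℕ) (w : List Bool) : Polynomial (ZMod p) :=
  ∑ i : Fin k, Polynomial.C (coeffAt ℓ w i : ZMod p) * Polynomial.X ^ (i : ℕ)

/-- The monic polynomial of degree `k` whose lower coefficients are listed in `w`. -/
noncomputable def modulus (p k ℓ : ℕ) (w : List Bool) : Polynomial (ZMod p) :=
  Polynomial.X ^ k + decodePoly p k ℓ w

theorem modulus_monic (p k ℓ : ℕ) (w : List Bool) : (modulus p k ℓ w).Monic :=
  Polynomial.monic_X_pow_add (Polynomial.degree_sum_fin_lt _)

/-- The `ℓ`-bit coefficients of the reduced representative of an element of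
`ZMod p [X] / (f)`, with `f` monic of degree `k`. -/
noncomputable def encodeElem {p : ℕ} (k ℓ : ℕ) {f : Polynomial (ZMod p)} (hf : f.Monic)
    (y : AdjoinRoot f) : List Bool :=
  (List.range k).flatMap fun i =>
    (List.range ℓ).map fun j => ((AdjoinRoot.modByMonicHom hf y).coeff i).val.testBit j

/-- The blocks of a word, where `none` is the separator. -/
def blocks : List (Option Bool) → List (List Bool)
  | [] => [[]]
  | none :: w => [] :: blocks w
  | some b :: w =>
    match blocks w with
    | [] => [[b]]
    | u :: us => (b :: u) :: us

open Classical in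
/-- The multilinear extension of the oracle `A`, as an oracle that answers a query
`p # f # x₁ # … # xₘ` by the value of the multilinear extension of `A m` over `ZMod p [X] / (f)` at
`(x₁, …, xₘ)`.  Words that do not have this form are answered by the empty word. -/
noncomputable def mlOracle (A : Oracle) (w : List (Option Bool)) : List Bool :=
  match blocks w with
  | pw :: fw :: xs =>
    let p := bitsToNat pw
    let ℓ := pw.length
    let k := fw.length / ℓ
    let f := modulus p k ℓ fw
    if p.Prime ∧ Irreducible f ∧ fw.length = k * ℓ ∧ ∀ x ∈ xs, x.length = k * ℓ then
      encodeElem k ℓ (modulus_monic p k ℓ fw)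
        (mlExt (AdjoinRoot f) (A xs.length) fun i => AdjoinRoot.mk f (decodePoly p k ℓ (xs.get i)))
    else []
  | _ => []

/-! ### Multitape oracle Turing machines -/

/-- Tape symbols: the blank `none`, the separator `some none`, the bits `some (some b)`. -/
abbrev Sym : Type := Option (Option Bool)

/-- A two-way infinite tape.  `right` lists the cells from the head to the right, `left` the cells
to the left of the head, nearest first; all further cells are blank. -/
structure Tape where
  left : List Sym
  right : List Sym

inductive Move : Type
  | left
  | stay
  | right

namespace Tape

/-- A tape that holds the word `w`, with the head on its first letter. -/
def ofBits (w : List Bool) : Tape := ⟨[], w.map fun b => some (some b)⟩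

def read (T : Tape) : Sym := T.right.headD none

def write (T : Tape) (s : Sym) : Tape := ⟨T.left, s :: T.right.tail⟩

def move (T : Tape) : Move → Tape
  | .left => ⟨T.left.tail, T.left.headD none :: T.right⟩
  | .stay => T
  | .right => ⟨T.read :: T.left, T.right.tail⟩

/-- The word that stretches from the head to the first blank. -/
def word (T : Tape) : List (Option Bool) := (T.right.takeWhile Option.isSome).reduceOption

end Tape

/-- The instructions of a machine with states `Q` and tapes `T`: halt and accept or reject; write,
move and change the state; query the oracle and change the state. -/
inductive Instr (Q T : Type) : Type
  | halt (accept : Bool)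
  | step (q : Q) (write : T → Sym) (move : T → Move)
  | query (q : Q)

/-- A deterministic oracle Turing machine with `j` input tapes, `work` work tapes and one oracle
tape (the index `none`). -/
structure OracleTM (j : ℕ) where
  work : ℕ
  states : ℕ
  start : Fin states
  trans : Fin states → (Option (Fin j ⊕ Fin work) → Sym) →
    Instr (Fin states) (Option (Fin j ⊕ Fin work))

namespace OracleTM

variable {j : ℕ}

structure Config (M : OracleTM j) where
  state : Fin M.states
  tapes : Option (Fin j ⊕ Fin M.work) → Tape

/-- The instruction that is carried out in a configuration. -/
def instr (M : OracleTM j) (c : M.Config) : Instr (Fin M.states) (Option (Fin j ⊕ Fin M.work)) :=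
  M.trans c.state fun i => (c.tapes i).read

/-- `M.HaltsIn O c t b`: from the configuration `c`, the machine `M` with oracle `O` halts in time
exactly `t`, accepting if `b = true` and rejecting if `b = false`.  A query replaces the query word
`w` on the oracle tape by the answer and takes time `|w| + 1`. -/
inductive HaltsIn (M : OracleTM j) (O : List (Option Bool) → List Bool) :
    M.Config → ℕ → Bool → Prop
  | halt {c : M.Config} {b : Bool} (h : M.instr c = .halt b) : HaltsIn M O c 1 b
  | step {c : M.Config} {q : Fin M.states} {s : Option (Fin j ⊕ Fin M.work) → Sym}
      {d : Option (Fin j ⊕ Fin M.work) → Move} {t : ℕ} {b : Bool}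
      (h : M.instr c = .step q s d)
      (h' : HaltsIn M O ⟨q, fun i => ((c.tapes i).write (s i)).move (d i)⟩ t b) :
      HaltsIn M O c (t + 1) b
  | query {c : M.Config} {q : Fin M.states} {t : ℕ} {b : Bool}
      (h : M.instr c = .query q)
      (h' : HaltsIn M O
        ⟨q, Function.update c.tapes none (Tape.ofBits (O (c.tapes none).word))⟩ t b) :
      HaltsIn M O c (t + ((c.tapes none).word.length + 1)) b

/-- The initial configuration: the input words on the input tapes, all other tapes blank. -/
def init (M : OracleTM j) (input : Fin j → List Bool) : M.Config :=
  ⟨M.start, fun i =>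
    match i with
    | some (.inl i) => Tape.ofBits (input i)
    | _ => Tape.ofBits []⟩

/-- `M` halts on the given input within time `T`. -/
def HaltsWithin (M : OracleTM j) (O : List (Option Bool) → List Bool)
    (input : Fin j → List Bool) (T : ℕ) : Prop :=
  ∃ t ≤ T, ∃ b, M.HaltsIn O (M.init input) t b

/-- `M` accepts the given input. -/
def Accepts (M : OracleTM j) (O : List (Option Bool) → List Bool)
    (input : Fin j → List Bool) : Prop :=
  ∃ t, M.HaltsIn O (M.init input) t true

end OracleTM

/-! ### Promise problems and the classes pr-PostBPE and pr-MA_E -/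

structure PromiseProblem where
  yes : Set (List Bool)
  no : Set (List Bool)
  disjoint : Disjoint yes no

/-- The probability of `P r` for a uniformly random `r ∈ {0,1}^n`. -/
noncomputable def prob {n : ℕ} (P : (Fin n → Bool) → Prop) : ℝ :=
  (Nat.card {r // P r} : ℝ) / 2 ^ n

/-- The conditional probability of `P r` given `Q r` for a uniformly random `r ∈ {0,1}^n`. -/
noncomputable def condProb {n : ℕ} (P Q : (Fin n → Bool) → Prop) : ℝ :=
  prob (fun r => P r ∧ Q r) / prob Q

/-- pr-PostBPE relative to the oracle `O`.  On inputs `x` of length `n` and randomness `r` of length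
`2^(d n)`, both machines run in time `2^(O(n))`; `N` accepts with positive probability, and
conditioned on this event `M` gives the right answer with probability at least `2/3`. -/
def prPostBPE (O : List (Option Bool) → List Bool) : Set PromiseProblem :=
  {L | ∃ (M N : OracleTM 2) (c d : ℕ),
    (∀ (x : List Bool) (r : Fin (2 ^ (d * x.length)) → Bool),
      M.HaltsWithin O ![x, List.ofFn r] (c * 2 ^ (c * x.length)) ∧
      N.HaltsWithin O ![x, List.ofFn r] (c * 2 ^ (c * x.length))) ∧
    (∀ x ∈ L.yes ∪ L.no,
      0 < prob (n := 2 ^ (d * x.length)) (fun r => N.Accepts O ![x, List.ofFn r])) ∧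
    (∀ x ∈ L.yes,
      2 / 3 ≤ condProb (n := 2 ^ (d * x.length)) (fun r => M.Accepts O ![x, List.ofFn r])
        (fun r => N.Accepts O ![x, List.ofFn r])) ∧
    (∀ x ∈ L.no,
      condProb (n := 2 ^ (d * x.length)) (fun r => M.Accepts O ![x, List.ofFn r])
        (fun r => N.Accepts O ![x, List.ofFn r]) ≤ 1 / 3)}

/-- pr-MA_E relative to the oracle `O`.  The verifier `V` gets an input `x` of length `n`, a proof
`u` of length `2^(d n)` and randomness `r` of length `2^(e n)`, and runs in time `2^(O(n))`. -/
def prMAE (O : List (Option Bool) → List Bool) : Set PromiseProblem :=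
  {L | ∃ (V : OracleTM 3) (c d e : ℕ),
    (∀ (x : List Bool) (u : Fin (2 ^ (d * x.length)) → Bool)
      (r : Fin (2 ^ (e * x.length)) → Bool),
      V.HaltsWithin O ![x, List.ofFn u, List.ofFn r] (c * 2 ^ (c * x.length))) ∧
    (∀ x ∈ L.yes, ∃ u : Fin (2 ^ (d * x.length)) → Bool,
      2 / 3 ≤ prob (n := 2 ^ (e * x.length))
        (fun r => V.Accepts O ![x, List.ofFn u, List.ofFn r])) ∧
    (∀ x ∈ L.no, ∀ u : Fin (2 ^ (d * x.length)) → Bool,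
      prob (n := 2 ^ (e * x.length))
        (fun r => V.Accepts O ![x, List.ofFn u, List.ofFn r]) ≤ 1 / 3)}

/-! ### Oracle circuits and i.o.-SIZE -/

/-- A gate whose inputs are chosen among `s` wires.  Oracle gates have arbitrary fan-in. -/
inductive Gate (s : ℕ) : Type
  | const (b : Bool)
  | not (i : Fin s)
  | and (i j : Fin s)
  | or (i j : Fin s)
  | oracle (m : ℕ) (v : Fin m → Fin s)

namespace Gate

variable {s : ℕ}

def fanin : Gate s → ℕ
  | .const _ => 0
  | .not _ => 1
  | .and _ _ => 2
  | .or _ _ => 2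
  | .oracle m _ => m

def eval (A : Oracle) (y : Fin s → Bool) : Gate s → Bool
  | .const b => b
  | .not i => !(y i)
  | .and i j => y i && y j
  | .or i j => y i || y j
  | .oracle m v => A m fun k => y (v k)

end Gate

/-- An oracle circuit with `n` inputs and `s` wires: the inputs, followed by gates each of which
reads earlier wires (so that fan-out is unbounded). -/
inductive Circuit (n : ℕ) : ℕ → Type
  | inputs : Circuit n n
  | gate {s : ℕ} (C : Circuit n s) (g : Gate s) : Circuit n (s + 1)

namespace Circuit

variable {n : ℕ}

/-- The size: the number of gates plus the sum of their fan-ins. -/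
def size : {s : ℕ} → Circuit n s → ℕ
  | _, .inputs => 0
  | _, .gate C g => C.size + (1 + g.fanin)

/-- The values of all wires on the input `x`. -/
def values (A : Oracle) (x : Fin n → Bool) : {s : ℕ} → Circuit n s → Fin s → Bool
  | _, .inputs => x
  | _, .gate C g => Fin.snoc (α := fun _ => Bool) (C.values A x) (g.eval A (C.values A x))

end Circuit

/-- i.o.-SIZE^A[σ]: for infinitely many `n`, the problem restricted to inputs of length `n` is
solved by an `A`-oracle circuit of size at most `σ n` (with output wire `out`). -/
def ioSIZE (A : Oracle) (σ : ℕ → ℕ) : Set PromiseProblem :=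
  {L | ∃ᶠ n in atTop, ∃ (s : ℕ) (C : Circuit n s) (out : Fin s), C.size ≤ σ n ∧
    ∀ x : Fin n → Bool,
      (List.ofFn x ∈ L.yes → C.values A x out = true) ∧
      (List.ofFn x ∈ L.no → C.values A x out = false)}

/-- i.o.-SIZE^A[O(n)]. -/
def ioSIZELinear (A : Oracle) : Set PromiseProblem :=
  ⋃ c : ℕ, ioSIZE A fun n => c * n

end Algebrization

/-!
The proof rests on a communication lower bound: postselected randomized protocols cannot produce a
string that avoids all exclusive ors `a i ⊕ b j` of the rows of Alice's matrix `a` and Bob's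
matrix `b`.

The answers of a machine at length `n` form a word of `2 ^ n` bits.  Two Boolean functions `A m`,
`A m'` of the oracle, at lengths `m`, `m'` with `m, m' = O(n)`, are read as two matrices `a`, `b`
with `2 ^ O(n)` rows of `2 ^ n` bits each.  If a row `a i` and a row `b j` satisfy that `a i ⊕ b j`
is the word of answers of the machine that has this very oracle, then a circuit of linear size with
two oracle gates and the constants `i`, `j` solves the problem at length `n`.

A query to the multilinear extension concerns one function `A m` only, and the answer is no longer
than the query.  So a run of length `T` partitions the pairs `(a, b)` into at most `2 ^ T`
combinatorial rectangles (`Split.rectSum_haltsBy`): Alice holds `a`, Bob holds `b`, and they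
exchange the answers.  All that is used about the two classes is that for every `x` there are
weights of the answers `false` and `true` that are sums of `2 ^ 2 ^ O(n)` rectangles and of which
the right one is at least twice as large as the other one (`AnswerWeights`).  For PostBPE the weight
of an answer is the number of random words for which it is given and the postselection succeeds; for
MA_E the weight of `true` is the sum over all proofs of a power of the acceptance probability, and
the weight of `false` is a constant threshold.

The combinatorial core is `exists_rows_xor`.  Multiplying large powers of the weights over all `x`,
one gets a weight `W y` for every word `y` of answers, and `W y` is negligible against the total
weight at `(a, b)` if `y` contains an error.  If `a i ⊕ b j` always contained an error, then
`W (a i ⊕ b j)` would be negligible for all `a`, `b`, `i`, `j`.  But `W y` is a sum of rectangles,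
nearly all of whose mass is in rectangles `A × B` that are dense in comparison to the number of
rows; for most rows `i` of a dense set `A`, most values of `a i` are taken about as often as on
average (`card_rows_few_light`), and likewise for `B`, and so `a i ⊕ b j = y` has at least about the
probability that it would have for random matrices (`card_rows_match`).  This contradicts the bound
on `W (a i ⊕ b j)`, on average over `a`, `b`, `i`, `j`.

Finally there are only countably many machines and running times, and a machine with a given time
bound sees a bounded part of the oracle, so an oracle that serves each of them at infinitely many
lengths is constructed in stages (`exists_oracle_encoding`).
-/

namespace Algebrization

open Finset

/-! ### Sums of few rectangles -/

/-- `g` is a sum of at most `K` indicator functions of combinatorial rectangles. -/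
def RectSum {X Y : Type*} (K : ℕ) (g : X → Y → ℕ) : Prop :=
  ∃ (ι : Type) (_ : Fintype ι) (A : ι → X → Bool) (B : ι → Y → Bool), Fintype.card ι ≤ K ∧
    ∀ a b, g a b = ∑ l, (A l a).toNat * (B l b).toNat

namespace RectSum

variable {X Y : Type*} {K K' : ℕ} {g g' : X → Y → ℕ}

theorem mono (h : RectSum K g) (hK : K ≤ K') : RectSum K' g := by
  obtain ⟨ι, _, A, B, hc, h⟩ := h
  exact ⟨ι, _, A, B, hc.trans hK, h⟩

theorem left (p : X → Bool) : RectSum 1 (fun a (_ : Y) => (p a).toNat) :=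
  ⟨Unit, inferInstance, fun _ => p, fun _ _ => true, by simp, by simp⟩

theorem const (c : ℕ) : RectSum c (fun (_ : X) (_ : Y) => c) :=
  ⟨Fin c, inferInstance, fun _ _ => true, fun _ _ => true, by simp, by simp⟩

theorem sum {ι : Type} [Fintype ι] {f : ι → X → Y → ℕ} (h : ∀ i, RectSum K (f i)) :
    RectSum (Fintype.card ι * K) (fun a b => ∑ i, f i a b) := by
  choose κ inst A B hc h using h
  refine ⟨Σ i, κ i, inferInstance, fun l => A l.1 l.2, fun l => B l.1 l.2, ?_, fun a b => ?_⟩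
  · rw [Fintype.card_sigma]
    exact (Finset.sum_le_card_nsmul _ _ K fun i _ => hc i).trans (by simp)
  · rw [Fintype.sum_sigma]
    exact Finset.sum_congr rfl fun i _ => h i a b

theorem add (h : RectSum K g) (h' : RectSum K' g') :
    RectSum (K + K') (fun a b => g a b + g' a b) := by
  obtain ⟨ι, _, A, B, hc, h⟩ := h
  obtain ⟨ι', _, A', B', hc', h'⟩ := h'
  refine ⟨ι ⊕ ι', inferInstance, Sum.elim A A', Sum.elim B B', ?_, fun a b => ?_⟩
  · rw [Fintype.card_sum]; omega
  · simp [h, h']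

theorem mul (h : RectSum K g) (h' : RectSum K' g') :
    RectSum (K * K') (fun a b => g a b * g' a b) := by
  obtain ⟨ι, _, A, B, hc, h⟩ := h
  obtain ⟨ι', _, A', B', hc', h'⟩ := h'
  refine ⟨ι × ι', inferInstance, fun l a => A l.1 a && A' l.2 a, fun l b => B l.1 b && B' l.2 b,
    ?_, fun a b => ?_⟩
  · rw [Fintype.card_prod]; exact Nat.mul_le_mul hc hc'
  · simp only [h, h']
    rw [Finset.sum_mul_sum, Fintype.sum_prod_type]
    refine Finset.sum_congr rfl fun i _ => Finset.sum_congr rfl fun j _ => ?_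
    cases A i a <;> cases A' j a <;> cases B i b <;> cases B' j b <;> rfl

theorem pow (h : RectSum K g) (k : ℕ) : RectSum (K ^ k) (fun a b => g a b ^ k) := by
  induction k with
  | zero => simpa using const 1
  | succ k ih => simpa only [pow_succ] using ih.mul h

theorem prod {ι : Type*} (s : Finset ι) {f : ι → X → Y → ℕ} (h : ∀ i ∈ s, RectSum K (f i)) :
    RectSum (K ^ #s) (fun a b => ∏ i ∈ s, f i a b) := by
  classical
  induction s using Finset.induction_on with
  | empty => simpa using const 1
  | insert i s hi ih =>
    have h1 := (h i (mem_insert_self i s)).mul (ih fun j hj => h j (mem_insert_of_mem hj))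
    simpa only [prod_insert hi, card_insert_of_notMem hi, pow_succ'] using h1

end RectSum

/-! ### Rows of dense sets of matrices -/

section Dense

variable {I J U : Type*} [Fintype I] [Fintype J] [Fintype U] [DecidableEq I] [DecidableEq J]
  [DecidableEq U]

/-- The values that the row `a i` takes less than half as often for `a ∈ A` as it would for a
uniformly random `a`. -/
def lightValues (A : Finset (I → U)) (i : I) : Finset U :=
  {u | 2 * Fintype.card U * #{a ∈ A | a i = u} < #A}

/-- A set of matrices is small if many values `u ∈ B i` are taken at most half as often by the row
`a i` as they would be on average.  The exponential moment `∑ exp (-φ a)` of the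
number `φ a` of `i` with `a i ∈ B i` is compared over `A`, where `φ` is at most half as large as
it is on average, and over all matrices, where it is a product over the rows. -/
theorem card_mul_exp_le [Nonempty U] (A : Finset (I → U)) (B : I → Finset U)
    (hB : ∀ i, ∀ u ∈ B i, 2 * Fintype.card U * #{a ∈ A | a i = u} ≤ #A) :
    (#A : ℝ) * Real.exp ((∑ i, (#(B i) : ℝ)) / Fintype.card U / 10) ≤
      (Fintype.card U : ℝ) ^ Fintype.card I := by
  set q : ℝ := (Fintype.card U : ℝ) with hq
  have hq0 : 0 < q := by rw [hq]; exact_mod_cast Fintype.card_pos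
  set μ : ℝ := (∑ i, (#(B i) : ℝ)) / q with hμ
  have hμ0 : 0 ≤ μ := div_nonneg (Finset.sum_nonneg fun i _ => Nat.cast_nonneg _) hq0.le
  let φ : (I → U) → ℝ := fun a => ∑ i, if a i ∈ B i then 1 else 0
  have hφ : ∑ a ∈ A, φ a ≤ #A * (μ / 2) := by
    have h1 : ∀ i, ∑ a ∈ A, (if a i ∈ B i then (1 : ℝ) else 0) ≤
        #(B i) * (#A / (2 * q)) := by
      intro i
      have h2 : ∑ a ∈ A, (if a i ∈ B i then (1 : ℝ) else 0) =
          ∑ u ∈ B i, (#{a ∈ A | a i = u} : ℝ) := by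
        simp only [Finset.card_filter, Nat.cast_sum, Nat.cast_ite, Nat.cast_one, Nat.cast_zero]
        rw [Finset.sum_comm]
        refine Finset.sum_congr rfl fun a _ => ?_
        rw [Finset.sum_ite_eq]
      rw [h2, ← nsmul_eq_mul]
      refine Finset.sum_le_card_nsmul _ _ _ fun u hu => ?_
      rw [le_div_iff₀ (by positivity)]
      have h4 : ((2 * Fintype.card U * #{a ∈ A | a i = u} : ℕ) : ℝ) ≤ (#A : ℝ) :=
        by exact_mod_cast hB i u hu
      push_cast at h4
      linarith
    calc ∑ a ∈ A, φ a = ∑ i, ∑ a ∈ A, (if a i ∈ B i then (1 : ℝ) else 0) :=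
          Finset.sum_comm
      _ ≤ ∑ i, #(B i) * (#A / (2 * q)) := Finset.sum_le_sum fun i _ => h1 i
      _ = #A * (μ / 2) := by rw [← Finset.sum_mul, hμ]; ring
  have hlow : #A * Real.exp (-(μ / 2)) ≤ ∑ a ∈ A, Real.exp (-φ a) := by
    -- The tangent of `exp` takes the place of Jensen's inequality.
    have h1 : ∀ a ∈ A, Real.exp (-(μ / 2)) * (μ / 2 - φ a + 1) ≤ Real.exp (-φ a) := by
      intro a _
      have h2 : Real.exp (-φ a) = Real.exp (-(μ / 2)) * Real.exp (μ / 2 - φ a) := by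
        rw [← Real.exp_add]; congr 1; ring
      rw [h2]
      exact mul_le_mul_of_nonneg_left (Real.add_one_le_exp _) (Real.exp_pos _).le
    refine le_trans ?_ (Finset.sum_le_sum h1)
    rw [← Finset.mul_sum, Finset.sum_add_distrib, Finset.sum_sub_distrib]
    simp only [Finset.sum_const, nsmul_eq_mul, mul_one]
    have := (Real.exp_pos (-(μ / 2)))
    nlinarith
  have hup : ∑ a : I → U, Real.exp (-φ a) ≤ q ^ Fintype.card I * Real.exp (-(3 / 5 * μ)) := by
    have h1 : ∑ a : I → U, Real.exp (-φ a) =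
        ∏ i, ∑ u, Real.exp (-if u ∈ B i then 1 else 0) := by
      rw [Finset.prod_univ_sum, Fintype.piFinset_univ]
      refine Finset.sum_congr rfl fun a _ => ?_
      rw [← Real.exp_sum, Finset.sum_neg_distrib]
    have h2 : ∀ i, ∑ u, Real.exp (-if u ∈ B i then 1 else 0) ≤
        q * Real.exp (-(3 / 5 * (#(B i) / q))) := by
      intro i
      have h3 : ∀ u : U, Real.exp (-if u ∈ B i then 1 else 0) ≤
          1 - 3 / 5 * (if u ∈ B i then 1 else 0) := by
        intro u
        split_ifs
        -- `1 - exp (-1)` exceeds `3 / 5`, hence also the `1 / 2` of the lower bound.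
        · have := Real.exp_neg_one_lt_d9; linarith
        · simp
      refine (Finset.sum_le_sum fun u _ => h3 u).trans ?_
      rw [Finset.sum_sub_distrib, ← Finset.mul_sum, Finset.sum_boole]
      simp only [Finset.sum_const, Finset.card_univ, nsmul_eq_mul, mul_one, Finset.filter_univ_mem]
      rw [← hq]
      have h4 := Real.add_one_le_exp (-(3 / 5 * (#(B i) / q)))
      have h5 : q - 3 / 5 * (#(B i) : ℝ) =
          q * (-(3 / 5 * (#(B i) / q)) + 1) := by field_simp; ring
      rw [h5]
      exact mul_le_mul_of_nonneg_left h4 hq0.le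
    rw [h1]
    refine (Finset.prod_le_prod (fun i _ => Finset.sum_nonneg fun u _ => (Real.exp_pos _).le)
      fun i _ => h2 i).trans_eq ?_
    rw [Finset.prod_mul_distrib, ← Real.exp_sum, Finset.prod_const, Finset.card_univ,
      Finset.sum_neg_distrib, ← Finset.mul_sum, hμ, Finset.sum_div]
  have hmid : ∑ a ∈ A, Real.exp (-φ a) ≤ ∑ a : I → U, Real.exp (-φ a) :=
    Finset.sum_le_univ_sum_of_nonneg fun a => (Real.exp_pos _).le
  have key := (hlow.trans hmid).trans hup
  have h6 := mul_le_mul_of_nonneg_right key (Real.exp_pos (3 / 5 * μ)).le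
  rw [mul_assoc, mul_assoc, ← Real.exp_add, ← Real.exp_add] at h6
  have e1 : -(μ / 2) + 3 / 5 * μ = μ / 10 := by ring
  have e2 : -(3 / 5 * μ) + 3 / 5 * μ = 0 := by ring
  rw [e1, e2, Real.exp_zero, mul_one] at h6
  exact h6

/-- In a dense set of matrices, at least three quarters of the rows have at most a quarter of light
values. -/
theorem card_rows_few_light [Nonempty U] (A : Finset (I → U)) (D : ℕ)
    (hA : Fintype.card U ^ Fintype.card I ≤ #A * 2 ^ D)
    (hD : 160 * D ≤ Fintype.card I) :
    3 * Fintype.card I ≤ 4 * #{i | 4 * #(lightValues A i) ≤ Fintype.card U} := by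
  have hU : 0 < Fintype.card U := Fintype.card_pos
  have hA0 : 0 < #A := by
    rcases Nat.eq_zero_or_pos #A with h | h
    · rw [h, zero_mul] at hA
      exact absurd hA (by have := pow_pos hU (Fintype.card I); omega)
    · exact h
  have h1 := card_mul_exp_le A (lightValues A) fun i u hu =>
    le_of_lt (Finset.mem_filter.mp hu).2
  set μ : ℝ := (∑ i, (#(lightValues A i) : ℝ)) / Fintype.card U with hμ
  have h2 : (#A : ℝ) * Real.exp (μ / 10) ≤ #A * 2 ^ D := h1.trans (by exact_mod_cast hA)
  have h3 : Real.exp (μ / 10) ≤ 2 ^ D := le_of_mul_le_mul_left h2 (by exact_mod_cast hA0)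
  have h4 : (2 : ℝ) ^ D ≤ Real.exp D := by
    rw [← mul_one (D : ℝ), Real.exp_nat_mul]
    exact pow_le_pow_left₀ (by norm_num) (by have := Real.exp_one_gt_d9; linarith) _
  have h5 : μ ≤ 10 * D := by
    have := Real.exp_le_exp.mp (h3.trans h4); linarith
  have h6 : (∑ i, (#(lightValues A i) : ℝ)) ≤ 10 * D * Fintype.card U := by
    rwa [hμ, div_le_iff₀ (by exact_mod_cast hU)] at h5
  have h7 : ∑ i, #(lightValues A i) ≤ 10 * D * Fintype.card U := by exact_mod_cast h6
  have h8 : #{i | ¬ 4 * #(lightValues A i) ≤ Fintype.card U} * Fintype.card U ≤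
      4 * ∑ i, #(lightValues A i) := by
    rw [Finset.mul_sum, ← smul_eq_mul]
    refine (Finset.card_nsmul_le_sum _ (fun i => 4 * #(lightValues A i)) _ fun i hi => ?_).trans
      (Finset.sum_le_sum_of_subset (Finset.subset_univ _))
    have := (Finset.mem_filter.mp hi).2
    omega
  have h9 : #{i | ¬ 4 * #(lightValues A i) ≤ Fintype.card U} ≤ 40 * D := by
    refine Nat.le_of_mul_le_mul_right ?_ hU
    nlinarith
  have h10 := Finset.card_filter_add_card_filter_not (s := (Finset.univ : Finset I))
    (fun i => 4 * #(lightValues A i) ≤ Fintype.card U)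
  rw [Finset.card_univ] at h10
  omega

/-- In a dense rectangle `A × B`, the event `b j = σ (a i)` has, for a random pair of rows, at least
a constant fraction of the probability that it has for random matrices. -/
theorem card_rows_match [Nonempty U] (A : Finset (I → U)) (B : Finset (J → U)) (D : ℕ)
    (hA : Fintype.card U ^ Fintype.card I ≤ #A * 2 ^ D)
    (hB : Fintype.card U ^ Fintype.card J ≤ #B * 2 ^ D)
    (hI : 160 * D ≤ Fintype.card I) (hJ : 160 * D ≤ Fintype.card J) (σ : Equiv.Perm U) :
    Fintype.card I * Fintype.card J * (#A * #B) ≤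
      16 * Fintype.card U *
        ∑ i, ∑ j, ∑ a ∈ A, ∑ b ∈ B, if b j = σ (a i) then 1 else 0 := by
  have hU : 0 < Fintype.card U := Fintype.card_pos
  set GI : Finset I := {i | 4 * #(lightValues A i) ≤ Fintype.card U}
  set GJ : Finset J := {j | 4 * #(lightValues B j) ≤ Fintype.card U}
  have hGI : 3 * Fintype.card I ≤ 4 * #GI := card_rows_few_light A D hA hI
  have hGJ : 3 * Fintype.card J ≤ 4 * #GJ := card_rows_few_light B D hB hJ
  have hpair : ∀ i ∈ GI, ∀ j ∈ GJ, #A * #B ≤ 8 * Fintype.card U *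
      ∑ a ∈ A, ∑ b ∈ B, if b j = σ (a i) then 1 else 0 := by
    intro i hi j hj
    have h1 : (∑ a ∈ A, ∑ b ∈ B, if b j = σ (a i) then 1 else 0) =
        ∑ u, #{a ∈ A | a i = u} * #{b ∈ B | b j = σ u} := by
      rw [← Finset.sum_fiberwise A (fun a => a i)]
      refine Finset.sum_congr rfl fun u _ => ?_
      rw [← smul_eq_mul, ← Finset.sum_const]
      refine Finset.sum_congr rfl fun a ha => ?_
      rw [(Finset.mem_filter.mp ha).2, Finset.card_filter]
    -- The product of the frequencies of `a i = u` and `b j = σ u` is bounded below for `u ∈ G`.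
    set G : Finset U := {u | u ∉ lightValues A i ∧ σ u ∉ lightValues B j}
    have hG : Fintype.card U ≤ 2 * #G := by
      have h2 : Gᶜ ⊆ lightValues A i ∪ (lightValues B j).map σ.symm.toEmbedding := by
        intro u hu
        simp only [G, Finset.mem_compl, Finset.mem_filter, Finset.mem_univ, true_and] at hu
        simp only [Finset.mem_union, Finset.mem_map_equiv, Equiv.symm_symm]
        tauto
      have h3 := (Finset.card_le_card h2).trans (Finset.card_union_le _ _)
      rw [Finset.card_map, Finset.card_compl] at h3
      have h4 : 4 * #(lightValues A i) ≤ Fintype.card U := (Finset.mem_filter.mp hi).2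
      have h5 : 4 * #(lightValues B j) ≤ Fintype.card U := (Finset.mem_filter.mp hj).2
      omega
    have h6 : ∀ u ∈ G, #A * #B ≤
        4 * Fintype.card U ^ 2 * (#{a ∈ A | a i = u} * #{b ∈ B | b j = σ u}) := by
      intro u hu
      simp only [G, lightValues, Finset.mem_filter, Finset.mem_univ, true_and, not_lt] at hu
      exact (Nat.mul_le_mul hu.1 hu.2).trans_eq (by ring)
    have h7 : #G * (#A * #B) ≤ 4 * Fintype.card U ^ 2 *
        ∑ u, #{a ∈ A | a i = u} * #{b ∈ B | b j = σ u} := by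
      rw [Finset.mul_sum, ← smul_eq_mul]
      exact (Finset.card_nsmul_le_sum _ _ _ h6).trans
        (Finset.sum_le_sum_of_subset (Finset.subset_univ _))
    rw [h1]
    refine Nat.le_of_mul_le_mul_left ?_ hU
    calc Fintype.card U * (#A * #B) ≤ 2 * #G * (#A * #B) := Nat.mul_le_mul_right _ hG
      _ = 2 * (#G * (#A * #B)) := by ring
      _ ≤ 2 * _ := Nat.mul_le_mul_left 2 h7
      _ = _ := by ring
  have h8 : #GI * #GJ * (#A * #B) ≤ 8 * Fintype.card U *
        ∑ i, ∑ j, ∑ a ∈ A, ∑ b ∈ B, if b j = σ (a i) then 1 else 0 := by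
    calc #GI * #GJ * (#A * #B) = ∑ i ∈ GI, ∑ j ∈ GJ, #A * #B := by simp [mul_assoc]
      _ ≤ ∑ i ∈ GI, ∑ j ∈ GJ, 8 * Fintype.card U *
          ∑ a ∈ A, ∑ b ∈ B, if b j = σ (a i) then 1 else 0 :=
        Finset.sum_le_sum fun i hi => Finset.sum_le_sum fun j hj => hpair i hi j hj
      _ ≤ ∑ i, ∑ j, 8 * Fintype.card U *
          ∑ a ∈ A, ∑ b ∈ B, if b j = σ (a i) then 1 else 0 :=
        (Finset.sum_le_sum fun i _ => Finset.sum_le_sum_of_subset (Finset.subset_univ _)).trans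
          (Finset.sum_le_sum_of_subset (Finset.subset_univ _))
      _ = _ := by simp only [Finset.mul_sum]
  have h9 : Fintype.card I * Fintype.card J ≤ 2 * (#GI * #GJ) := by nlinarith
  calc Fintype.card I * Fintype.card J * (#A * #B) ≤ 2 * (#GI * #GJ) * (#A * #B) :=
        Nat.mul_le_mul_right _ h9
    _ = 2 * (#GI * #GJ * (#A * #B)) := by ring
    _ ≤ 2 * _ := Nat.mul_le_mul_left 2 h8
    _ = _ := by ring

/-- The bound of `card_rows_match` for a positive sum of few rectangles, of which the sparse ones
contribute at most half of the total. -/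
theorem RectSum.rows_match [Nonempty U] {D : ℕ} {W : (I → U) → (J → U) → ℕ}
    (hW : RectSum (2 ^ D) W) (hpos : ∀ a b, 0 < W a b)
    (hI : 160 * (D + 1) ≤ Fintype.card I) (hJ : 160 * (D + 1) ≤ Fintype.card J)
    (σ : Equiv.Perm U) :
    Fintype.card I * Fintype.card J * ∑ a, ∑ b, W a b ≤
      32 * Fintype.card U *
        ∑ i, ∑ j, ∑ a, ∑ b, if b j = σ (a i) then W a b else 0 := by
  obtain ⟨ι, _, A, B, hc, h⟩ := hW
  let A' : ι → Finset (I → U) := fun l => {a | A l a = true}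
  let B' : ι → Finset (J → U) := fun l => {b | B l b = true}
  have hexp : ∀ e : (I → U) → (J → U) → ℕ,
      ∑ a, ∑ b, W a b * e a b = ∑ l, ∑ a ∈ A' l, ∑ b ∈ B' l, e a b := by
    intro e
    simp only [h, Finset.sum_mul]
    have hcomm : ∀ f : (I → U) → (J → U) → ι → ℕ,
        ∑ a, ∑ b, ∑ l, f a b l = ∑ l, ∑ a, ∑ b, f a b l := fun f =>
      (Finset.sum_congr rfl fun a _ => Finset.sum_comm).trans Finset.sum_comm
    rw [hcomm]
    refine Finset.sum_congr rfl fun l _ => ?_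
    simp only [A', B', Finset.sum_filter]
    refine Finset.sum_congr rfl fun a _ => ?_
    cases A l a
    · simp
    · refine (Finset.sum_congr rfl fun b _ => ?_).trans (if_pos rfl).symm
      cases B l b <;> simp
  have htot : ∑ a, ∑ b, W a b = ∑ l, #(A' l) * #(B' l) := by
    simpa using hexp fun _ _ => 1
  have hmatch : (∑ i, ∑ j, ∑ a, ∑ b, if b j = σ (a i) then W a b else 0) =
      ∑ l, ∑ i, ∑ j, ∑ a ∈ A' l, ∑ b ∈ B' l, if b j = σ (a i) then 1 else 0 := by
    symm
    rw [Finset.sum_comm]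
    refine Finset.sum_congr rfl fun i _ => ?_
    rw [Finset.sum_comm]
    refine Finset.sum_congr rfl fun j _ => ?_
    rw [← hexp]
    simp only [mul_ite, mul_one, mul_zero]
  set q := Fintype.card U
  set P := Fintype.card I * Fintype.card J
  set T := q ^ Fintype.card I * q ^ Fintype.card J with hT
  have hcA : ∀ l, #(A' l) ≤ q ^ Fintype.card I := fun l =>
    (Finset.card_le_univ _).trans_eq (by simp [q])
  have hcB : ∀ l, #(B' l) ≤ q ^ Fintype.card J := fun l =>
    (Finset.card_le_univ _).trans_eq (by simp [q])
  -- The last summand makes the bound trivial for sparse rectangles.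
  have hl : ∀ l, 2 ^ (D + 1) * (P * (#(A' l) * #(B' l))) ≤ 2 ^ (D + 1) * (16 * q *
      ∑ i, ∑ j, ∑ a ∈ A' l, ∑ b ∈ B' l, if b j = σ (a i) then 1 else 0) + P * T := by
    intro l
    by_cases hA : q ^ Fintype.card I ≤ #(A' l) * 2 ^ (D + 1)
    · by_cases hB : q ^ Fintype.card J ≤ #(B' l) * 2 ^ (D + 1)
      · exact (Nat.mul_le_mul_left _ (card_rows_match _ _ (D + 1) hA hB hI hJ σ)).trans
          (Nat.le_add_right _ _)
      · refine le_trans ?_ (Nat.le_add_left _ _)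
        have := Nat.mul_le_mul_left P (Nat.mul_le_mul (hcA l) (not_le.mp hB).le)
        exact le_trans (le_of_eq (by ring)) this
    · refine le_trans ?_ (Nat.le_add_left _ _)
      have := Nat.mul_le_mul_left P (Nat.mul_le_mul (not_le.mp hA).le (hcB l))
      exact le_trans (le_of_eq (by ring)) this
  have hTle : T ≤ ∑ a, ∑ b, W a b := by
    calc T = ∑ a : I → U, ∑ b : J → U, 1 := by simp [hT, q]
      _ ≤ _ := Finset.sum_le_sum fun a _ => Finset.sum_le_sum fun b _ => hpos a b
  have hsum := Finset.sum_le_sum fun l (_ : l ∈ Finset.univ) => hl l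
  rw [Finset.sum_add_distrib, ← Finset.mul_sum, ← Finset.mul_sum, ← Finset.mul_sum,
    ← Finset.mul_sum, ← htot, ← hmatch, Finset.sum_const, Finset.card_univ, smul_eq_mul] at hsum
  have h1 : Fintype.card ι * (P * T) ≤ 2 ^ D * (P * ∑ a, ∑ b, W a b) :=
    Nat.mul_le_mul hc (Nat.mul_le_mul_left P hTle)
  refine Nat.le_of_mul_le_mul_left (c := 2 ^ D) ?_ (Nat.two_pow_pos D)
  rw [pow_succ] at hsum
  linarith

end Dense

/-! ### Rows that agree with the majority of the weight -/

/-- Let `H c x a b`, for each position `x`, be a weight in favour of the bit `c`, and let it be a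
sum of few rectangles.  If the matrices have many rows, then for some matrices the exclusive or of
two rows agrees with the bit that is favoured, wherever the weights differ by a factor of two.

Otherwise, let `W y = ∏ x, (H (y x) x + 1) ^ k`, which is again a sum of few rectangles.  For all
`a`, `b` the words `y = a i ⊕ b j` have at most a `(2 / 3) ^ k` fraction of the total weight at
`(a, b)`; but by `RectSum.rows_match` they have on average a fraction of about `1 / |U|`. -/
theorem exists_rows_xor {S I J : Type*} [Fintype S] [Fintype I] [Fintype J] [Nonempty S]
    {κ : ℕ} {H : Bool → S → (I → S → Bool) → (J → S → Bool) → ℕ}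
    (hH : ∀ c x, RectSum (2 ^ κ) (H c x))
    (hI : 160 * ((κ + 1) * (16 * Fintype.card S) * Fintype.card S + 1) ≤ Fintype.card I)
    (hJ : 160 * ((κ + 1) * (16 * Fintype.card S) * Fintype.card S + 1) ≤ Fintype.card J) :
    ∃ a b i j, ∀ x c, 2 * H (!c) x a b ≤ H c x a b → 0 < H c x a b →
      xor (a i x) (b j x) = c := by
  classical
  by_contra! hcon
  set N := Fintype.card S with hN
  have hN0 : 0 < N := Fintype.card_pos
  -- This exponent makes `(3 / 2) ^ k` larger than `32 * 2 ^ N`.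
  set k := 16 * N with hk
  have hI0 : 0 < Fintype.card I := by omega
  have hJ0 : 0 < Fintype.card J := by omega
  -- The summand `1` makes `W` positive; a factor of `2` between the weights remains one of `3 / 2`.
  let W : (S → Bool) → (I → S → Bool) → (J → S → Bool) → ℕ := fun y a b =>
    ∏ x, (H (y x) x a b + 1) ^ k
  have hWpos : ∀ y a b, 0 < W y a b := fun y a b =>
    Finset.prod_pos fun x _ => pow_pos (Nat.succ_pos _) _
  have hWrect : ∀ y, RectSum (2 ^ ((κ + 1) * k * N)) (W y) := by
    intro y
    have h1 : ∀ x ∈ (Finset.univ : Finset S), RectSum ((2 ^ (κ + 1)) ^ k)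
        (fun a b => (H (y x) x a b + 1) ^ k) := fun x _ =>
      (((hH (y x) x).add (RectSum.const 1)).mono
        (by rw [pow_succ]; have := Nat.one_le_two_pow (n := κ); omega)).pow k
    have h2 := RectSum.prod _ h1
    rwa [← pow_mul, ← pow_mul, ← mul_assoc, Finset.card_univ] at h2
  have hlow : ∀ y, Fintype.card I * Fintype.card J * ∑ a, ∑ b, W y a b ≤
      32 * 2 ^ N * ∑ i, ∑ j, ∑ a, ∑ b,
        if y = (fun x => xor (a i x) (b j x)) then W y a b else 0 := by
    intro y
    let σ : Equiv.Perm (S → Bool) := Function.Involutive.toPerm (fun u x => xor (u x) (y x))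
      (fun u => by funext x; simp)
    have h1 := (hWrect y).rows_match (hWpos y) hI hJ σ
    have h2 : Fintype.card (S → Bool) = 2 ^ N := by simp [hN]
    rw [h2] at h1
    refine h1.trans_eq (congrArg (32 * 2 ^ N * ·) ?_)
    refine Finset.sum_congr rfl fun i _ => Finset.sum_congr rfl fun j _ =>
      Finset.sum_congr rfl fun a _ => Finset.sum_congr rfl fun b _ => ?_
    refine if_congr ?_ rfl rfl
    rw [funext_iff, funext_iff]
    refine forall_congr' fun x => ?_
    change b j x = xor (a i x) (y x) ↔ _
    cases a i x <;> cases b j x <;> cases y x <;> decide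
  have hup : ∀ a b i j, 3 ^ k * W (fun x => xor (a i x) (b j x)) a b ≤
      2 ^ k * ∑ y, W y a b := by
    intro a b i j
    obtain ⟨x, c, h1, h2, h3⟩ := hcon a b i j
    set y : S → Bool := fun x => xor (a i x) (b j x) with hy
    have hyx : y x = !c := by
      have : y x ≠ c := h3
      revert this; cases y x <;> cases c <;> decide
    have h4 : 3 ^ k * W y a b ≤ 2 ^ k * W (Function.update y x c) a b := by
      simp only [W]
      rw [← Finset.mul_prod_erase _ _ (Finset.mem_univ x),
        ← Finset.mul_prod_erase _ (fun x' => (H (Function.update y x c x') x' a b + 1) ^ k)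
          (Finset.mem_univ x)]
      have h5 : ∏ x' ∈ Finset.univ.erase x, (H (Function.update y x c x') x' a b + 1) ^ k =
          ∏ x' ∈ Finset.univ.erase x, (H (y x') x' a b + 1) ^ k := by
        refine Finset.prod_congr rfl fun x' hx' => ?_
        rw [Function.update_of_ne (Finset.ne_of_mem_erase hx')]
      rw [h5, ← mul_assoc, ← mul_assoc, ← mul_pow, ← mul_pow, Function.update_self, hyx]
      exact Nat.mul_le_mul_right _ (Nat.pow_le_pow_left (by omega) k)
    refine h4.trans (Nat.mul_le_mul_left _ ?_)
    exact Finset.single_le_sum (f := fun y => W y a b) (fun _ _ => Nat.zero_le _)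
      (Finset.mem_univ _)
  set T := ∑ y, ∑ a, ∑ b, W y a b with hT
  have hTpos : 0 < T := by
    have : Nonempty I := Fintype.card_pos_iff.mp hI0
    have : Nonempty J := Fintype.card_pos_iff.mp hJ0
    exact Finset.sum_pos (fun y _ => Finset.sum_pos (fun a _ => Finset.sum_pos
      (fun b _ => hWpos y a b) Finset.univ_nonempty) Finset.univ_nonempty) Finset.univ_nonempty
  set V := ∑ i, ∑ j, ∑ a : I → S → Bool, ∑ b : J → S → Bool,
    W (fun x => xor (a i x) (b j x)) a b with hV
  have hlow' : Fintype.card I * Fintype.card J * T ≤ 32 * 2 ^ N * V := by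
    rw [hT, Finset.mul_sum]
    refine (Finset.sum_le_sum fun y _ => hlow y).trans_eq ?_
    rw [← Finset.mul_sum, hV, Finset.sum_comm]
    refine congrArg (32 * 2 ^ N * ·) ?_
    refine Finset.sum_congr rfl fun i _ => ?_
    rw [Finset.sum_comm]
    refine Finset.sum_congr rfl fun j _ => ?_
    rw [Finset.sum_comm]
    refine Finset.sum_congr rfl fun a _ => ?_
    rw [Finset.sum_comm]
    refine Finset.sum_congr rfl fun b _ => ?_
    rw [Finset.sum_ite_eq' Finset.univ, if_pos (Finset.mem_univ _)]
  have hup' : 3 ^ k * V ≤ 2 ^ k * (Fintype.card I * Fintype.card J * T) := by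
    have h1 : ∀ i j, 3 ^ k * ∑ a : I → S → Bool, ∑ b : J → S → Bool,
        W (fun x => xor (a i x) (b j x)) a b ≤ 2 ^ k * T := by
      intro i j
      have h2 : T = ∑ a, ∑ b, ∑ y, W y a b := by
        rw [hT, Finset.sum_comm]
        exact Finset.sum_congr rfl fun a _ => Finset.sum_comm
      rw [h2]
      simp only [Finset.mul_sum (s := (Finset.univ : Finset (I → S → Bool))),
        Finset.mul_sum (s := (Finset.univ : Finset (J → S → Bool)))]
      exact Finset.sum_le_sum fun a _ => Finset.sum_le_sum fun b _ => hup a b i j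
    calc 3 ^ k * V = ∑ i, ∑ j, 3 ^ k * ∑ a : I → S → Bool, ∑ b : J → S → Bool,
          W (fun x => xor (a i x) (b j x)) a b := by
          rw [hV, Finset.mul_sum]; simp only [Finset.mul_sum (s := (Finset.univ : Finset J))]
      _ ≤ ∑ i : I, ∑ j : J, 2 ^ k * T :=
          Finset.sum_le_sum fun i _ => Finset.sum_le_sum fun j _ => h1 i j
      _ = _ := by simp; ring
  have h3 : 3 ^ k * (Fintype.card I * Fintype.card J * T) ≤
      32 * 2 ^ N * 2 ^ k * (Fintype.card I * Fintype.card J * T) := by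
    calc _ ≤ 3 ^ k * (32 * 2 ^ N * V) := Nat.mul_le_mul_left _ hlow'
      _ = 32 * 2 ^ N * (3 ^ k * V) := by ring
      _ ≤ 32 * 2 ^ N * _ := Nat.mul_le_mul_left _ hup'
      _ = _ := by ring
  have h4 : 3 ^ k ≤ 32 * 2 ^ N * 2 ^ k := Nat.le_of_mul_le_mul_right h3 (by positivity)
  have h5 : 32 * 2 ^ N * 2 ^ k ≤ (32 * 2 * 2 ^ 16) ^ N := by
    rw [mul_pow, mul_pow, ← pow_mul, hk]
    exact Nat.mul_le_mul_right _ (Nat.mul_le_mul_right _ (Nat.le_self_pow hN0.ne' 32))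
  have h6 : (32 * 2 * 2 ^ 16) ^ N < 3 ^ k := by
    rw [hk, pow_mul]
    exact Nat.pow_lt_pow_left (by norm_num) hN0.ne'
  omega

/-! ### What a query can see -/

theorem blocks_length (w : List (Option Bool)) :
    ((blocks w).map List.length).sum + (blocks w).length ≤ w.length + 1 := by
  induction w with
  | nil => simp [blocks]
  | cons s w ih =>
    cases s with
    | none => simp [blocks]; omega
    | some b =>
      rw [blocks]
      cases h : blocks w with
      | nil => simp
      | cons u us => rw [h] at ih; simp at ih ⊢; omega

/-- The answer to a query depends on one of the Boolean functions of the oracle only. -/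
theorem exists_mlOracle_congr (w : List (Option Bool)) :
    ∃ m ≤ w.length, ∀ A A' : Oracle, A m = A' m → mlOracle A w = mlOracle A' w := by
  have h := blocks_length w
  rcases hw : blocks w with _ | ⟨pw, _ | ⟨fw, xs⟩⟩
  · exact ⟨0, Nat.zero_le _, fun A A' _ => by simp only [mlOracle, hw]⟩
  · exact ⟨0, Nat.zero_le _, fun A A' _ => by simp only [mlOracle, hw]⟩
  · refine ⟨xs.length, ?_, fun A A' hA => by simp only [mlOracle, hw, hA]⟩
    rw [hw] at h
    simp at h
    omega

theorem exists_length_mlOracle (w : List (Option Bool)) :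
    ∃ ℓ ≤ w.length, ∀ A : Oracle, (mlOracle A w).length = ℓ := by
  have h := blocks_length w
  rcases hw : blocks w with _ | ⟨pw, _ | ⟨fw, xs⟩⟩
  · exact ⟨0, Nat.zero_le _, fun A => by simp [mlOracle, hw]⟩
  · exact ⟨0, Nat.zero_le _, fun A => by simp [mlOracle, hw]⟩
  · rw [hw] at h
    simp at h
    by_cases hq : (bitsToNat pw).Prime ∧
        Irreducible (modulus (bitsToNat pw) (fw.length / pw.length) pw.length fw) ∧
        fw.length = fw.length / pw.length * pw.length ∧
        ∀ x ∈ xs, x.length = fw.length / pw.length * pw.length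
    · refine ⟨fw.length, by omega, fun A => ?_⟩
      simp only [mlOracle, hw]
      rw [if_pos hq, encodeElem, List.length_flatMap]
      simp only [List.length_map, List.length_range, List.map_const', List.sum_replicate,
        smul_eq_mul]
      exact hq.2.2.1.symm
    · refine ⟨0, Nat.zero_le _, fun A => ?_⟩
      simp only [mlOracle, hw]
      rw [if_neg hq, List.length_nil]

/-! ### Clocked computations -/

namespace OracleTM

variable {j : ℕ} {M : OracleTM j} {O O' : List (Option Bool) → List Bool}

/-- From the configuration `c`, the machine halts with result `b` within time `T`. -/
def HaltsBy (M : OracleTM j) (O : List (Option Bool) → List Bool) (c : M.Config) (T : ℕ)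
    (b : Bool) : Prop :=
  ∃ t ≤ T, M.HaltsIn O c t b

theorem HaltsIn.unique {c : M.Config} {t t' : ℕ} {b b' : Bool} (h : M.HaltsIn O c t b)
    (h' : M.HaltsIn O c t' b') : t = t' ∧ b = b' := by
  induction h generalizing t' with
  | halt h => cases h' <;> simp_all
  | step h _ ih =>
    cases h' with
    | halt k => simp_all
    | query k => simp_all
    | step k k' =>
      rw [h] at k
      injection k with k1 k2 k3
      subst k1 k2 k3
      have := ih k'
      simp_all
  | query h _ ih =>
    cases h' with
    | halt k => simp_all
    | step k => simp_all
    | query k k' =>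
      rw [h] at k
      injection k with k1
      subst k1
      have := ih k'
      simp_all

theorem HaltsIn.congr {c : M.Config} {t : ℕ} {b : Bool} (h : M.HaltsIn O c t b)
    (hO : ∀ w, w.length < t → O w = O' w) : M.HaltsIn O' c t b := by
  induction h with
  | halt h => exact .halt h
  | step h _ ih => exact .step h (ih fun w hw => hO w (by omega))
  | query h _ ih =>
    refine .query h ?_
    rw [← hO _ (by omega)]
    exact ih fun w hw => hO w (by omega)

theorem haltsBy_congr {c : M.Config} {T : ℕ} {b : Bool}
    (hO : ∀ w, w.length < T → O w = O' w) : M.HaltsBy O c T b ↔ M.HaltsBy O' c T b :=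
  ⟨fun ⟨t, ht, h⟩ => ⟨t, ht, h.congr fun w hw => hO w (by omega)⟩,
    fun ⟨t, ht, h⟩ => ⟨t, ht, h.congr fun w hw => (hO w (by omega)).symm⟩⟩

theorem haltsBy_mlOracle_congr {A A' : Oracle} {c : M.Config} {T : ℕ} {b : Bool}
    (hA : ∀ m ≤ T, A m = A' m) :
    M.HaltsBy (mlOracle A) c T b ↔ M.HaltsBy (mlOracle A') c T b :=
  haltsBy_congr fun w hw => by
    obtain ⟨m, hm, h⟩ := exists_mlOracle_congr w
    exact h A A' (hA m (by omega))

theorem HaltsWithin.accepts_iff {input : Fin j → List Bool} {T : ℕ}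
    (h : M.HaltsWithin O input T) :
    M.Accepts O input ↔ M.HaltsBy O (M.init input) T true := by
  obtain ⟨t, ht, b, h⟩ := h
  constructor
  · rintro ⟨t', h'⟩
    obtain ⟨rfl, rfl⟩ := h.unique h'
    exact ⟨t, ht, h⟩
  · rintro ⟨t, _, h⟩
    exact ⟨t, h⟩

theorem HaltsWithin.not_accepts_iff {input : Fin j → List Bool} {T : ℕ}
    (h : M.HaltsWithin O input T) :
    ¬ M.Accepts O input ↔ M.HaltsBy O (M.init input) T false := by
  obtain ⟨t, ht, b, h⟩ := h
  constructor
  · intro h'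
    cases b
    · exact ⟨t, ht, h⟩
    · exact absurd ⟨t, h⟩ h'
  · rintro ⟨t', _, h'⟩ ⟨t'', h''⟩
    exact absurd (h'.unique h'').2 (by decide)

end OracleTM

/-! ### Computations as sums of rectangles -/

/-- A family of oracles, each function of which is determined either by the first or by the second
parameter. -/
def Split {X Y : Type*} (A : X → Y → Oracle) : Prop :=
  ∀ m, (∃ g : X → (Fin m → Bool) → Bool, ∀ a b, A a b m = g a) ∨
    ∃ g : Y → (Fin m → Bool) → Bool, ∀ a b, A a b m = g b

section Rect

variable {X Y : Type*}

theorem RectSum.branch_left {K ℓ : ℕ} {g : List Bool → X → Y → ℕ} (hg : ∀ v, RectSum K (g v))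
    (f : X → List Bool) (hf : ∀ a, (f a).length = ℓ) :
    RectSum (2 ^ ℓ * K) (fun a b => g (f a) a b) := by
  have h1 := RectSum.sum fun v : Fin ℓ → Bool =>
    (RectSum.left (Y := Y) fun a => decide (f a = List.ofFn v)).mul (hg (List.ofFn v))
  rw [Fintype.card_fun, Fintype.card_bool, Fintype.card_fin, one_mul] at h1
  convert h1 using 3 with a b
  obtain ⟨v, hv⟩ : ∃ v : Fin ℓ → Bool, f a = List.ofFn v :=
    ⟨fun i => (f a).get (i.cast (hf a).symm), by
      apply List.ext_get <;> simp [hf]⟩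
  rw [Finset.sum_eq_single v]
  · simp [hv]
  · intro v' _ hv'
    rw [hv, decide_eq_false fun h => hv' (List.ofFn_injective h).symm]
    simp
  · simp

theorem RectSum.swap {K : ℕ} {g : X → Y → ℕ} (h : RectSum K g) : RectSum K fun b a => g a b := by
  obtain ⟨ι, _, A, B, hc, h⟩ := h
  exact ⟨ι, _, B, A, hc, fun b a => by simp only [h, mul_comm]⟩

theorem RectSum.branch_right {K ℓ : ℕ} {g : List Bool → X → Y → ℕ} (hg : ∀ v, RectSum K (g v))
    (f : Y → List Bool) (hf : ∀ b, (f b).length = ℓ) :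
    RectSum (2 ^ ℓ * K) (fun a b => g (f b) a b) :=
  (RectSum.branch_left (fun v => (hg v).swap) f hf).swap

open Classical in
/-- A computation of length `T` distinguishes at most `2 ^ T` rectangles of oracles: the answer to a
query depends on one of the parameters only, and is no longer than the query. -/
theorem Split.rectSum_haltsBy {A : X → Y → Oracle} (hA : Split A) {j : ℕ} (M : OracleTM j)
    (T : ℕ) (c : M.Config) (r : Bool) :
    RectSum (2 ^ T) fun a b => (decide (M.HaltsBy (mlOracle (A a b)) c T r)).toNat := by
  induction T using Nat.strong_induction_on generalizing c with
  | _ T ih =>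
  cases hc : M.instr c with
  | halt r' =>
    have h1 : ∀ a b, M.HaltsBy (mlOracle (A a b)) c T r ↔ 1 ≤ T ∧ r = r' := by
      refine fun a b => ⟨?_, ?_⟩
      · rintro ⟨t, ht, h⟩
        cases h <;> simp_all
      · rintro ⟨hT, rfl⟩
        exact ⟨1, hT, .halt hc⟩
    simp only [h1]
    exact (RectSum.left fun _ => _).mono Nat.one_le_two_pow
  | step q s d =>
    cases T with
    | zero =>
      have h1 : ∀ a b, ¬ M.HaltsBy (mlOracle (A a b)) c 0 r := by
        rintro a b ⟨t, ht, h⟩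
        cases h <;> omega
      simp only [h1]
      exact (RectSum.left fun _ => _).mono Nat.one_le_two_pow
    | succ T =>
      have h1 : ∀ a b, M.HaltsBy (mlOracle (A a b)) c (T + 1) r ↔
          M.HaltsBy (mlOracle (A a b)) ⟨q, fun i => ((c.tapes i).write (s i)).move (d i)⟩ T r := by
        refine fun a b => ⟨?_, ?_⟩
        · rintro ⟨t, ht, h⟩
          cases h with
          | halt k => simp_all
          | query k => simp_all
          | step k k' =>
            rw [hc] at k
            injection k with k1 k2 k3
            subst k1 k2 k3
            exact ⟨_, by omega, k'⟩
        · rintro ⟨t, ht, h⟩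
          exact ⟨t + 1, by omega, .step hc h⟩
      simp only [h1]
      exact (ih T (Nat.lt_succ_self T) _).mono (Nat.pow_le_pow_right (by norm_num) (Nat.le_succ T))
  | query q =>
    set w := (c.tapes none).word with hw
    by_cases hT : w.length + 1 ≤ T
    · obtain ⟨T', rfl⟩ := Nat.exists_eq_add_of_le' hT
      have h1 : ∀ a b, M.HaltsBy (mlOracle (A a b)) c (T' + (w.length + 1)) r ↔
          M.HaltsBy (mlOracle (A a b))
            ⟨q, Function.update c.tapes none (Tape.ofBits (mlOracle (A a b) w))⟩ T' r := by
        refine fun a b => ⟨?_, ?_⟩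
        · rintro ⟨t, ht, h⟩
          cases h with
          | halt k => simp_all
          | step k => simp_all
          | query k k' =>
            rw [hc] at k
            injection k with k1
            subst k1
            rw [← hw] at ht
            exact ⟨_, by omega, k'⟩
        · rintro ⟨t, ht, h⟩
          exact ⟨t + (w.length + 1), by omega, .query hc h⟩
      simp only [h1]
      obtain ⟨m, -, hm⟩ := exists_mlOracle_congr w
      obtain ⟨ℓ, hℓ, hlen⟩ := exists_length_mlOracle w
      have hg := fun v => ih T' (by omega)
        ⟨q, Function.update c.tapes none (Tape.ofBits v)⟩
      have hcard : 2 ^ ℓ * 2 ^ T' ≤ 2 ^ (T' + (w.length + 1)) := by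
        rw [← pow_add]
        exact Nat.pow_le_pow_right (by norm_num) (by omega)
      rcases hA m with ⟨g, h⟩ | ⟨g, h⟩
      · let f : X → List Bool := fun a =>
          mlOracle (Function.update (fun _ _ => false) m (g a)) w
        have hf : ∀ a b, mlOracle (A a b) w = f a := fun a b => hm _ _ (by rw [h]; simp)
        simp only [hf]
        exact (RectSum.branch_left hg f fun a => hlen _).mono hcard
      · let f : Y → List Bool := fun b =>
          mlOracle (Function.update (fun _ _ => false) m (g b)) w
        have hf : ∀ a b, mlOracle (A a b) w = f b := fun a b => hm _ _ (by rw [h]; simp)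
        simp only [hf]
        exact (RectSum.branch_right hg f fun a => hlen _).mono hcard
    · have h1 : ∀ a b, ¬ M.HaltsBy (mlOracle (A a b)) c T r := by
        rintro a b ⟨t, ht, h⟩
        cases h with
        | halt k => simp_all
        | step k => simp_all
        | query k k' => rw [← hw] at ht; omega
      simp only [h1]
      exact (RectSum.left fun _ => _).mono Nat.one_le_two_pow

end Rect

/-! ### Weights that compare the two answers -/

/-- For every word `x`, oracle-dependent weights of the answers `false` and `true`.  On words of
length `n` the weights only depend on `A m` for `m ≤ use n`, and as functions of two parameters
between which the oracle is split they are sums of `2 ^ (2 ^ O(n))` rectangles. -/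
structure AnswerWeights where
  weight : (n : ℕ) → Bool → (Fin n → Bool) → Oracle → ℕ
  use : ℕ → ℕ
  exponent : ℕ
  congr : ∀ n c x A A', (∀ m ≤ use n, A m = A' m) → weight n c x A = weight n c x A'
  rectSum : ∀ {X Y : Type} (A : X → Y → Oracle), Split A → ∀ n c x,
    RectSum (2 ^ (exponent * 2 ^ (exponent * n))) fun a b => weight n c x (A a b)

/-- The exclusive or of two rows, which are stored in the oracle at the lengths `h + n` and
`h + 1 + n`, agrees with every answer that has at least twice the weight of the opposite answer. -/
def AnswerWeights.Encoded (Q : AnswerWeights) (n h : ℕ) (A : Oracle) : Prop :=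
  ∃ (i : Fin h → Bool) (j : Fin (h + 1) → Bool), ∀ x c,
    2 * Q.weight n (!c) x A ≤ Q.weight n c x A → 0 < Q.weight n c x A →
      xor (A (h + n) (Fin.append i x)) (A (h + 1 + n) (Fin.append j x)) = c

/-- The address length for which the oracle has sufficiently many rows. -/
def AnswerWeights.addressLength (Q : AnswerWeights) (n : ℕ) : ℕ := (2 * Q.exponent + 15) * n

theorem rows_bound {C n : ℕ} (hn : 0 < n) :
    160 * ((C * 2 ^ (C * n) + 1) * (16 * 2 ^ n) * 2 ^ n + 1) ≤ 2 ^ ((2 * C + 15) * n) := by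
  have h1 : C ≤ 2 ^ (C * n) := by
    calc C ≤ C * n := Nat.le_mul_of_pos_right C hn
      _ ≤ 2 ^ (C * n) := Nat.lt_two_pow_self.le
  have h2 : C * 2 ^ (C * n) + 1 ≤ 2 * (2 ^ (C * n) * 2 ^ (C * n)) := by
    have := Nat.one_le_two_pow (n := C * n)
    nlinarith
  have h3 : 1 ≤ (2 ^ (C * n) * 2 ^ (C * n)) * (2 ^ n * 2 ^ n) := Nat.one_le_iff_ne_zero.mpr
    (by positivity)
  have h4 : 2 ^ 13 ≤ (2 ^ 13) ^ n := Nat.le_self_pow hn.ne' _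
  calc 160 * ((C * 2 ^ (C * n) + 1) * (16 * 2 ^ n) * 2 ^ n + 1)
      ≤ 160 * (2 * (2 ^ (C * n) * 2 ^ (C * n)) * (16 * 2 ^ n) * 2 ^ n + 1) := by gcongr
    _ ≤ 2 ^ 13 * ((2 ^ (C * n) * 2 ^ (C * n)) * (2 ^ n * 2 ^ n)) := by
        generalize 2 ^ (C * n) = p at *
        generalize 2 ^ n = q at *
        have e : 2 * (p * p) * (16 * q) * q = 32 * ((p * p) * (q * q)) := by ring
        rw [e]
        omega
    _ ≤ (2 ^ 13) ^ n * ((2 ^ (C * n) * 2 ^ (C * n)) * (2 ^ n * 2 ^ n)) :=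
        Nat.mul_le_mul_right _ h4
    _ = 2 ^ ((2 * C + 15) * n) := by
        rw [← pow_mul, ← pow_add, ← pow_add, ← pow_add, ← pow_add]
        congr 1
        ring

theorem AnswerWeights.Encoded.congr {Q : AnswerWeights} {n h : ℕ} {A A' : Oracle}
    (hA : Q.Encoded n h A) (hA' : ∀ m ≤ max (Q.use n) (h + 1 + n), A m = A' m) :
    Q.Encoded n h A' := by
  obtain ⟨i, j, H⟩ := hA
  refine ⟨i, j, fun x c => ?_⟩
  have h1 : ∀ c, Q.weight n c x A' = Q.weight n c x A := fun c =>
    (Q.congr n c x A A' fun m hm => hA' m (hm.trans (le_max_left _ _))).symm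
  rw [h1, h1, ← hA' _ (le_max_right _ _),
    ← hA' (h + n) (le_trans (by omega) (le_max_right _ _))]
  exact H x c

/-- Every oracle can be modified at two lengths such that the answers at length `n` are encoded. -/
theorem AnswerWeights.exists_encoded (Q : AnswerWeights) (A₀ : Oracle) {n : ℕ} (hn : 0 < n) :
    ∃ A : Oracle, (∀ m < n, A m = A₀ m) ∧ Q.Encoded n (Q.addressLength n) A := by
  set h := Q.addressLength n with hh
  let A : ((Fin h → Bool) → (Fin n → Bool) → Bool) →
      ((Fin (h + 1) → Bool) → (Fin n → Bool) → Bool) → Oracle := fun a b =>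
    Function.update (Function.update A₀ (h + n)
      fun z => a (fun k => z (Fin.castAdd n k)) fun k => z (Fin.natAdd h k)) (h + 1 + n)
      fun z => b (fun k => z (Fin.castAdd n k)) fun k => z (Fin.natAdd (h + 1) k)
  have hA1 : ∀ a b, A a b (h + n) =
      fun z => a (fun k => z (Fin.castAdd n k)) fun k => z (Fin.natAdd h k) := fun a b => by
    simp only [A]
    rw [Function.update_of_ne (by omega), Function.update_self]
  have hA2 : ∀ a b, A a b (h + 1 + n) =
      fun z => b (fun k => z (Fin.castAdd n k)) fun k => z (Fin.natAdd (h + 1) k) := fun a b => by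
    simp only [A]
    rw [Function.update_self]
  have hA3 : ∀ a b m, m ≠ h + n → m ≠ h + 1 + n → A a b m = A₀ m := fun a b m h1 h2 => by
    simp only [A]
    rw [Function.update_of_ne h2, Function.update_of_ne h1]
  have hsplit : Split A := by
    intro m
    by_cases h1 : m = h + n
    · subst h1
      exact .inl ⟨_, fun a b => hA1 a b⟩
    by_cases h2 : m = h + 1 + n
    · subst h2
      exact .inr ⟨_, fun a b => hA2 a b⟩
    · exact .inl ⟨fun _ => A₀ m, fun a b => hA3 a b m h1 h2⟩
  have hrows := rows_bound (C := Q.exponent) hn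
  have hS : Fintype.card (Fin n → Bool) = 2 ^ n := by simp
  obtain ⟨a, b, i, j, H⟩ := exists_rows_xor (S := Fin n → Bool) (I := Fin h → Bool)
    (J := Fin (h + 1) → Bool) (κ := Q.exponent * 2 ^ (Q.exponent * n))
    (H := fun c x a b => Q.weight n c x (A a b))
    (fun c x => Q.rectSum A hsplit n c x)
    (by rw [hS]; refine hrows.trans_eq ?_; simp [hh, AnswerWeights.addressLength])
    (by
      rw [hS]
      refine hrows.trans ?_
      rw [Fintype.card_fun, Fintype.card_bool, Fintype.card_fin]
      exact Nat.pow_le_pow_right (by norm_num) (Nat.le_succ _))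
  refine ⟨A a b, fun m hm => hA3 a b m (by omega) (by omega), i, j, fun x c h1 h2 => ?_⟩
  rw [hA1, hA2]
  simp only [Fin.append_left, Fin.append_right]
  exact H x c h1 h2

/-! ### The oracle -/

/-- For countably many weights, there is an oracle that encodes the answers of each of them at
infinitely many lengths: each of infinitely many stages treats one of them, at lengths that are not
visible at the previous stages. -/
theorem exists_oracle_encoding {ι : Type*} [Countable ι] (Q : ι → AnswerWeights) :
    ∃ A : Oracle, ∀ i, ∃ᶠ n in atTop, (Q i).Encoded n ((Q i).addressLength n) A := by
  rcases isEmpty_or_nonempty ι with hι | hι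
  · exact ⟨fun _ _ => false, fun i => hι.elim i⟩
  obtain ⟨e, he⟩ := exists_surjective_nat ι
  let q : ℕ → AnswerWeights := fun s => Q (e (Nat.unpair s).1)
  -- A stage maps an oracle and a bound below which it is fixed to the next such pair.
  let bound : ℕ → ℕ → ℕ := fun s B =>
    max (max ((q s).use (B + 1)) ((q s).addressLength (B + 1) + 1 + (B + 1))) (B + 1)
  choose next hnext henc using fun (s : ℕ) (P : Oracle × ℕ) =>
    (q s).exists_encoded P.1 (Nat.succ_pos P.2)
  let stage : ℕ → Oracle × ℕ := fun s =>
    Nat.rec (fun _ _ => false, 0) (fun s P => (next s P, bound s P.2)) s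
  have hstage : ∀ s, stage (s + 1) = (next s (stage s), bound s (stage s).2) := fun _ => rfl
  have hB : ∀ s, (stage s).2 + 1 ≤ (stage (s + 1)).2 := fun s => le_max_right _ _
  have hBmono : StrictMono fun s => (stage s).2 := strictMono_nat_of_lt_succ hB
  have hagree : ∀ s s', s ≤ s' → ∀ m ≤ (stage s).2, (stage s').1 m = (stage s).1 m := by
    intro s s' hs
    induction s', hs using Nat.le_induction with
    | base => exact fun _ _ => rfl
    | succ s' hs ih =>
      intro m hm
      rw [← ih m hm, hstage]
      exact hnext s' (stage s') m (Nat.lt_succ_of_le (hm.trans (hBmono.monotone hs)))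
  let A : Oracle := fun m => (stage m).1 m
  have hA : ∀ s, ∀ m ≤ (stage s).2, (stage s).1 m = A m := by
    intro s m hm
    rcases le_total s m with h | h
    · exact (hagree s m h m hm).symm
    · exact hagree m s h m (hBmono.id_le m)
  refine ⟨A, fun i => ?_⟩
  obtain ⟨k, rfl⟩ := he i
  rw [frequently_atTop]
  intro n₀
  set s := Nat.pair k n₀ with hs
  have hq : q s = Q (e k) := by simp [q, hs]
  refine ⟨(stage s).2 + 1, ?_, ?_⟩
  · exact ((Nat.right_le_pair k n₀).trans (hBmono.id_le s)).trans (Nat.le_succ _)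
  · rw [← hq]
    exact (henc s (stage s)).congr fun m hm => hA (s + 1) m (hm.trans (le_max_left _ _))

/-! ### Counting accepting random words -/

open Classical in
/-- The number of `r ∈ {0,1}^n` with `P r`. -/
noncomputable def count {n : ℕ} (P : (Fin n → Bool) → Prop) : ℕ :=
  ∑ r, (decide (P r)).toNat

section Count

variable {n : ℕ} (P Q : (Fin n → Bool) → Prop)

theorem prob_eq : prob P = (count P : ℝ) / 2 ^ n := by
  classical
  rw [prob, count, Nat.card_eq_fintype_card, Fintype.card_subtype, Finset.card_filter]
  congr 2
  refine Finset.sum_congr rfl fun r _ => ?_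
  by_cases h : P r <;> simp [h]

open Classical in
theorem count_and : count (fun r => P r ∧ Q r) =
    ∑ r, (decide (P r)).toNat * (decide (Q r)).toNat :=
  Finset.sum_congr rfl fun r _ => by by_cases h : P r <;> by_cases h' : Q r <;> simp [h, h']

theorem count_add_count_not :
    count (fun r => P r ∧ Q r) + count (fun r => ¬ P r ∧ Q r) = count Q := by
  classical
  rw [count, count, count, ← Finset.sum_add_distrib]
  refine Finset.sum_congr rfl fun r _ => ?_
  by_cases h : P r <;> by_cases h' : Q r <;> simp [h, h']

theorem condProb_eq : condProb P Q = (count (fun r => P r ∧ Q r) : ℝ) / count Q := by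
  rw [condProb, prob_eq, prob_eq, div_div_div_cancel_right₀ (by positivity)]

variable {P Q}

theorem count_pos_of_prob_pos (h : 0 < prob Q) : 0 < count Q := by
  rcases Nat.eq_zero_or_pos (count Q) with h0 | h0
  · rw [prob_eq, h0] at h; simp at h
  · exact h0

theorem count_of_two_thirds_le_condProb (h : 0 < prob Q) (hP : 2 / 3 ≤ condProb P Q) :
    2 * count (fun r => ¬ P r ∧ Q r) ≤ count (fun r => P r ∧ Q r) ∧
      0 < count (fun r => P r ∧ Q r) := by
  have h0 := count_pos_of_prob_pos h
  have h1 := count_add_count_not P Q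
  rw [condProb_eq, le_div_iff₀ (by exact_mod_cast h0)] at hP
  have h2 : 2 * count Q ≤ 3 * count (fun r => P r ∧ Q r) := by
    have : (2 * count Q : ℝ) ≤ 3 * count (fun r => P r ∧ Q r) := by linarith
    exact_mod_cast this
  omega

theorem count_of_condProb_le_one_third (h : 0 < prob Q) (hP : condProb P Q ≤ 1 / 3) :
    2 * count (fun r => P r ∧ Q r) ≤ count (fun r => ¬ P r ∧ Q r) ∧
      0 < count (fun r => ¬ P r ∧ Q r) := by
  have h0 := count_pos_of_prob_pos h
  have h1 := count_add_count_not P Q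
  rw [condProb_eq, div_le_iff₀ (by exact_mod_cast h0)] at hP
  have h2 : 3 * count (fun r => P r ∧ Q r) ≤ count Q := by
    have : (3 * count (fun r => P r ∧ Q r) : ℝ) ≤ count Q := by linarith
    exact_mod_cast this
  omega

theorem le_count_of_two_thirds_le_prob (h : 2 / 3 ≤ prob P) : 2 * 2 ^ n ≤ 3 * count P := by
  rw [prob_eq, le_div_iff₀ (by positivity)] at h
  have : (2 * 2 ^ n : ℝ) ≤ 3 * count P := by linarith
  exact_mod_cast this

theorem count_le_of_prob_le_one_third (h : prob P ≤ 1 / 3) : 3 * count P ≤ 2 ^ n := by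
  rw [prob_eq, div_le_iff₀ (by positivity)] at h
  have : (3 * count P : ℝ) ≤ 2 ^ n := by linarith
  exact_mod_cast this

end Count

/-! ### The weights of the two classes -/

theorem two_pow_le_of_le_mul_two_pow {a b C n s : ℕ} (ha : a ≤ C) (hb : b ≤ C)
    (hs : s ≤ a * 2 ^ (b * n)) :
    2 ^ s ≤ 2 ^ (C * 2 ^ (C * n)) :=
  Nat.pow_le_pow_right (by norm_num) (hs.trans (by gcongr; norm_num))

/-- The weight of an answer is the number of random words `r` for which the postselecting machine
`N` accepts and `M` gives this answer. -/
noncomputable def postBPEWeights (M N : OracleTM 2) (c d : ℕ) : AnswerWeights where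
  weight n b x A := count fun r : Fin (2 ^ (d * n)) → Bool =>
    M.HaltsBy (mlOracle A) (M.init ![List.ofFn x, List.ofFn r]) (c * 2 ^ (c * n)) b ∧
    N.HaltsBy (mlOracle A) (N.init ![List.ofFn x, List.ofFn r]) (c * 2 ^ (c * n)) true
  use n := c * 2 ^ (c * n)
  exponent := 1 + 2 * c + d
  congr n b x A A' h := by
    simp only [OracleTM.haltsBy_mlOracle_congr h]
  rectSum A hA n b x := by
    have h1 := RectSum.sum fun r : Fin (2 ^ (d * n)) → Bool =>
      (hA.rectSum_haltsBy M (c * 2 ^ (c * n)) (M.init ![List.ofFn x, List.ofFn r]) b).mul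
        (hA.rectSum_haltsBy N (c * 2 ^ (c * n)) (N.init ![List.ofFn x, List.ofFn r]) true)
    rw [Fintype.card_fun, Fintype.card_bool, Fintype.card_fin, ← pow_add, ← pow_add] at h1
    simp only [count_and]
    refine h1.mono (two_pow_le_of_le_mul_two_pow (a := 1 + 2 * c) (b := c + d)
      (C := 1 + 2 * c + d) (by omega) (by omega) ?_)
    rw [add_mul c d, pow_add]
    have := Nat.one_le_two_pow (n := c * n)
    have := Nat.one_le_two_pow (n := d * n)
    generalize 2 ^ (c * n) = p at *
    generalize 2 ^ (d * n) = q at *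
    have h2 : q ≤ p * q := Nat.le_mul_of_pos_left _ (by omega)
    have h3 : p ≤ p * q := Nat.le_mul_of_pos_right _ (by omega)
    have h4 : c * p ≤ c * (p * q) := Nat.mul_le_mul_left c h3
    calc _ = q + 2 * (c * p) := by ring
      _ ≤ p * q + 2 * (c * (p * q)) := by omega
      _ = _ := by ring

/-- The weight of the answer `true` is, up to a factor, the sum over all proofs of the `k`-th power
of the acceptance probability, which counts the successes of `k = 2 ^ (d n) + 2` independent
verifications of a random proof.  The constant weight of the answer `false` is the threshold
between the sum over `2 ^ 2 ^ (d n)` bad proofs and the contribution of a single good proof. -/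
noncomputable def maeWeights (V : OracleTM 3) (c d e : ℕ) : AnswerWeights where
  weight n b x A :=
    bif b then 3 ^ (2 ^ (d * n) + 2) * ∑ u : Fin (2 ^ (d * n)) → Bool,
      count (fun r : Fin (2 ^ (e * n)) → Bool =>
        V.HaltsBy (mlOracle A) (V.init ![List.ofFn x, List.ofFn u, List.ofFn r])
          (c * 2 ^ (c * n)) true) ^ (2 ^ (d * n) + 2)
    else 2 ^ (2 ^ (d * n) + 1) * (2 ^ 2 ^ (e * n)) ^ (2 ^ (d * n) + 2)
  use n := c * 2 ^ (c * n)
  exponent := 10 + 3 * c + d + e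
  congr n b x A A' h := by
    simp only [OracleTM.haltsBy_mlOracle_congr h]
  rectSum A hA n b x := by
    have hp := Nat.one_le_two_pow (n := c * n)
    have hq := Nat.one_le_two_pow (n := d * n)
    have hs := Nat.one_le_two_pow (n := e * n)
    have hbound : ∀ s, s ≤ (10 + 3 * c) * (2 ^ (c * n) * 2 ^ (d * n) * 2 ^ (e * n)) →
        2 ^ s ≤ 2 ^ ((10 + 3 * c + d + e) * 2 ^ ((10 + 3 * c + d + e) * n)) := fun s h =>
      two_pow_le_of_le_mul_two_pow (a := 10 + 3 * c) (b := c + d + e) (by omega) (by omega)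
        (by rwa [add_mul (c + d) e, pow_add, add_mul c d, pow_add])
    cases b with
    | false =>
      simp only [cond_false]
      refine (RectSum.const _).mono ?_
      rw [← pow_mul, ← pow_add]
      refine hbound _ ?_
      generalize 2 ^ (c * n) = p at *
      generalize 2 ^ (d * n) = q at *
      generalize 2 ^ (e * n) = s at *
      have h1 : q * s ≤ p * q * s := by
        rw [mul_assoc]; exact Nat.le_mul_of_pos_left _ (by omega)
      have h2 : q ≤ q * s := Nat.le_mul_of_pos_right _ (by omega)
      have h3 : s ≤ q * s := Nat.le_mul_of_pos_left _ (by omega)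
      calc q + 1 + s * (q + 2) = q + 1 + q * s + 2 * s := by ring
        _ ≤ 10 * (p * q * s) := by omega
        _ ≤ _ := Nat.mul_le_mul_right _ (by omega)
    | true =>
      simp only [cond_true]
      have h1 := (RectSum.const (3 ^ (2 ^ (d * n) + 2))).mul
        (RectSum.sum fun u : Fin (2 ^ (d * n)) → Bool =>
        (RectSum.sum fun r : Fin (2 ^ (e * n)) → Bool =>
          hA.rectSum_haltsBy V (c * 2 ^ (c * n))
            (V.init ![List.ofFn x, List.ofFn u, List.ofFn r]) true).pow (2 ^ (d * n) + 2))
      rw [Fintype.card_fun, Fintype.card_bool, Fintype.card_fin, Fintype.card_fun,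
        Fintype.card_bool, Fintype.card_fin] at h1
      refine h1.mono (le_trans (Nat.mul_le_mul_right _
        (Nat.pow_le_pow_left (by norm_num : 3 ≤ 2 ^ 2) _)) ?_)
      rw [← pow_mul, ← pow_add, ← pow_mul, ← pow_add, ← pow_add]
      refine hbound _ ?_
      generalize 2 ^ (c * n) = p at *
      generalize 2 ^ (d * n) = q at *
      generalize 2 ^ (e * n) = s at *
      have h1 : q * s ≤ p * q * s := by
        rw [mul_assoc]; exact Nat.le_mul_of_pos_left _ (by omega)
      have h2 : q ≤ q * s := Nat.le_mul_of_pos_right _ (by omega)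
      have h3 : s ≤ q * s := Nat.le_mul_of_pos_left _ (by omega)
      have h4 : p * q ≤ p * q * s := Nat.le_mul_of_pos_right _ (by omega)
      have h5 : p ≤ p * q := Nat.le_mul_of_pos_right _ (by omega)
      have h6 : c * (p * q) ≤ c * (p * q * s) := Nat.mul_le_mul_left c h4
      have h7 : c * p ≤ c * (p * q) := Nat.mul_le_mul_left c h5
      calc 2 * (q + 2) + (q + (s + c * p) * (q + 2))
          = 3 * q + 4 + q * s + 2 * s + c * (p * q) + 2 * (c * p) := by ring
        _ ≤ 10 * (p * q * s) + 3 * (c * (p * q * s)) := by omega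
        _ = _ := by ring

/-! ### Countably many machines -/

instance : Countable Move :=
  Function.Injective.countable (f := fun m : Move => match m with
    | .left => 0
    | .stay => 1
    | .right => (2 : ℕ)) fun a b h => by cases a <;> cases b <;> simp_all

instance (Q T : Type) [Countable Q] [Finite T] : Countable (Instr Q T) :=
  Function.Injective.countable
    (f := fun i : Instr Q T => match i with
      | .halt b => (Sum.inl b : Bool ⊕ ((Q × (T → Sym) × (T → Move)) ⊕ Q))
      | .step q s d => .inr (.inl (q, s, d))
      | .query q => .inr (.inr q))
    fun a b h => by cases a <;> cases b <;> simp_all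

instance (j : ℕ) : Countable (OracleTM j) :=
  Function.Injective.countable
    (f := fun M : OracleTM j => (⟨(M.work, M.states), M.start, M.trans⟩ :
      Σ p : ℕ × ℕ, Fin p.2 × (Fin p.2 → (Option (Fin j ⊕ Fin p.1) → Sym) →
        Instr (Fin p.2) (Option (Fin j ⊕ Fin p.1)))))
    fun M M' h => by
      cases M; cases M'
      simp only [Sigma.mk.injEq, Prod.mk.injEq] at h
      obtain ⟨⟨rfl, rfl⟩, h⟩ := h
      simp only [heq_eq_eq, Prod.mk.injEq] at h
      obtain ⟨rfl, rfl⟩ := h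
      rfl

/-! ### Circuits -/

/-- Some `A`-oracle circuit of size at most `σ` computes all functions in `F`, on some of its
wires. -/
def Realizes (A : Oracle) {n : ℕ} (σ : ℕ) (F : Set ((Fin n → Bool) → Bool)) : Prop :=
  ∃ (s : ℕ) (C : Circuit n s), C.size ≤ σ ∧ ∀ f ∈ F, ∃ w, ∀ x, C.values A x w = f x

namespace Realizes

variable {A : Oracle} {n σ : ℕ} {F : Set ((Fin n → Bool) → Bool)}

theorem inputs : Realizes A 0 (Set.range fun (i : Fin n) (x : Fin n → Bool) => x i) :=
  ⟨n, .inputs, le_rfl, by rintro _ ⟨i, rfl⟩; exact ⟨i, fun x => rfl⟩⟩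

theorem oracle (h : Realizes A σ F) {m : ℕ} (v : Fin m → (Fin n → Bool) → Bool)
    (hv : ∀ k, v k ∈ F) :
    Realizes A (σ + (1 + m)) (insert (fun x => A m fun k => v k x) F) := by
  obtain ⟨s, C, hC, hF⟩ := h
  choose w hw using fun k => hF (v k) (hv k)
  refine ⟨s + 1, C.gate (.oracle m w), Nat.add_le_add_right hC _, ?_⟩
  rintro f (rfl | hf)
  · exact ⟨Fin.last s, fun x => by simp [Circuit.values, Gate.eval, hw]⟩
  · obtain ⟨w', hw'⟩ := hF f hf
    exact ⟨w'.castSucc, fun x => by simp [Circuit.values, hw']⟩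

theorem const (h : Realizes A σ F) (b : Bool) : Realizes A (σ + 1) (insert (fun _ => b) F) := by
  obtain ⟨s, C, hC, hF⟩ := h
  refine ⟨s + 1, C.gate (.const b), Nat.add_le_add_right hC _, ?_⟩
  rintro f (rfl | hf)
  · exact ⟨Fin.last s, fun x => by simp [Circuit.values, Gate.eval]⟩
  · obtain ⟨w', hw'⟩ := hF f hf
    exact ⟨w'.castSucc, fun x => by simp [Circuit.values, hw']⟩

theorem not (h : Realizes A σ F) {f : (Fin n → Bool) → Bool} (hf : f ∈ F) :
    Realizes A (σ + 2) (insert (fun x => !f x) F) := by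
  obtain ⟨s, C, hC, hF⟩ := h
  obtain ⟨w, hw⟩ := hF f hf
  refine ⟨s + 1, C.gate (.not w), Nat.add_le_add_right hC _, ?_⟩
  rintro f (rfl | hf)
  · exact ⟨Fin.last s, fun x => by simp [Circuit.values, Gate.eval, hw]⟩
  · obtain ⟨w', hw'⟩ := hF f hf
    exact ⟨w'.castSucc, fun x => by simp [Circuit.values, hw']⟩

theorem and (h : Realizes A σ F) {f g : (Fin n → Bool) → Bool} (hf : f ∈ F) (hg : g ∈ F) :
    Realizes A (σ + 3) (insert (fun x => f x && g x) F) := by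
  obtain ⟨s, C, hC, hF⟩ := h
  obtain ⟨w, hw⟩ := hF f hf
  obtain ⟨v, hv⟩ := hF g hg
  refine ⟨s + 1, C.gate (.and w v), Nat.add_le_add_right hC _, ?_⟩
  rintro f (rfl | hf)
  · exact ⟨Fin.last s, fun x => by simp [Circuit.values, Gate.eval, hw, hv]⟩
  · obtain ⟨w', hw'⟩ := hF f hf
    exact ⟨w'.castSucc, fun x => by simp [Circuit.values, hw']⟩

theorem or (h : Realizes A σ F) {f g : (Fin n → Bool) → Bool} (hf : f ∈ F) (hg : g ∈ F) :
    Realizes A (σ + 3) (insert (fun x => f x || g x) F) := by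
  obtain ⟨s, C, hC, hF⟩ := h
  obtain ⟨w, hw⟩ := hF f hf
  obtain ⟨v, hv⟩ := hF g hg
  refine ⟨s + 1, C.gate (.or w v), Nat.add_le_add_right hC _, ?_⟩
  rintro f (rfl | hf)
  · exact ⟨Fin.last s, fun x => by simp [Circuit.values, Gate.eval, hw, hv]⟩
  · obtain ⟨w', hw'⟩ := hF f hf
    exact ⟨w'.castSucc, fun x => by simp [Circuit.values, hw']⟩

theorem xor (h : Realizes A σ F) {f g : (Fin n → Bool) → Bool} (hf : f ∈ F) (hg : g ∈ F) :
    Realizes A (σ + 11) {fun x => Bool.xor (f x) (g x)} := by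
  obtain ⟨s, C, hC, hF⟩ := (((h.or hf hg).and (Set.mem_insert_of_mem _ hf)
    (Set.mem_insert_of_mem _ hg)).not (Set.mem_insert _ _)).and
      (Set.mem_insert_of_mem _ (Set.mem_insert_of_mem _ (Set.mem_insert _ _))) (Set.mem_insert _ _)
  refine ⟨s, C, hC, ?_⟩
  rintro _ rfl
  obtain ⟨w, hw⟩ := hF _ (Set.mem_insert _ _)
  refine ⟨w, fun x => ?_⟩
  rw [hw]
  change _ = Bool.xor (f x) (g x)
  cases f x <;> cases g x <;> rfl

end Realizes

/-- The exclusive or of two rows of the oracle is computed by a small circuit. -/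
theorem realizes_xor_rows (A : Oracle) {n h h' : ℕ} (i : Fin h → Bool) (j : Fin h' → Bool) :
    Realizes A (15 + (h + n) + (h' + n))
      {fun x : Fin n → Bool => xor (A (h + n) (Fin.append i x)) (A (h' + n) (Fin.append j x))} := by
  have h1 := (Realizes.inputs (A := A) (n := n)).const true |>.const false
  have hv : ∀ {m : ℕ} (i : Fin m → Bool) (k : Fin (m + n)),
      (fun x : Fin n → Bool => (Fin.append i x : Fin (m + n) → Bool) k) ∈
        insert (fun _ => false) (insert (fun _ => true)
          (Set.range fun (i : Fin n) (x : Fin n → Bool) => x i)) := by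
    intro m i k
    refine Fin.addCases (fun k => ?_) (fun k => ?_) k
    · simp only [Fin.append_left]
      cases i k
      · exact .inl rfl
      · exact .inr (.inl rfl)
    · simp only [Fin.append_right]
      exact .inr (.inr ⟨k, rfl⟩)
  have h2 := h1.oracle _ (hv i)
  have h3 := h2.oracle (fun k x => (Fin.append j x : Fin (h' + n) → Bool) k)
    fun k => .inr (hv j k)
  obtain ⟨s, C, hC, hF⟩ := h3.xor (.inr (.inl rfl)) (.inl rfl)
  exact ⟨s, C, hC.trans (by omega), hF⟩

theorem mem_ioSIZELinear_of_encoded {A : Oracle} (Q : AnswerWeights) {L : PromiseProblem}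
    (hA : ∃ᶠ n in atTop, Q.Encoded n (Q.addressLength n) A)
    (hyes : ∀ (n : ℕ) (x : Fin n → Bool), List.ofFn x ∈ L.yes →
      2 * Q.weight n false x A ≤ Q.weight n true x A ∧ 0 < Q.weight n true x A)
    (hno : ∀ (n : ℕ) (x : Fin n → Bool), List.ofFn x ∈ L.no →
      2 * Q.weight n true x A ≤ Q.weight n false x A ∧ 0 < Q.weight n false x A) :
    L ∈ ioSIZELinear A := by
  refine Set.mem_iUnion.mpr ⟨18 + 2 * (2 * Q.exponent + 15), ?_⟩
  refine (hA.and_eventually (eventually_ge_atTop 1)).mono ?_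
  rintro n ⟨⟨i, j, H⟩, hn⟩
  obtain ⟨s, C, hC, hF⟩ := realizes_xor_rows A i j
  obtain ⟨w, hw⟩ := hF _ rfl
  refine ⟨s, C, w, hC.trans ?_, fun x => ⟨fun hx => ?_, fun hx => ?_⟩⟩
  · change _ ≤ (18 + 2 * (2 * Q.exponent + 15)) * n
    rw [AnswerWeights.addressLength, add_mul 18, mul_assoc 2]
    omega
  · rw [hw]
    exact H x true (hyes n x hx).1 (hyes n x hx).2
  · rw [hw]
    exact H x false (hno n x hx).1 (hno n x hx).2

end Algebrization

open Algebrization in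
/-- There is an oracle `A` with multilinear extension `Ã` such that
pr-PostBPE^Ã ⊆ i.o.-SIZE^A[O(n)], and likewise pr-MA_E^Ã ⊆ i.o.-SIZE^A[O(n)]. -/
theorem theorem1 :
    ∃ A : Algebrization.Oracle,
      Algebrization.prPostBPE (Algebrization.mlOracle A) ⊆ Algebrization.ioSIZELinear A ∧
      Algebrization.prMAE (Algebrization.mlOracle A) ⊆ Algebrization.ioSIZELinear A := by
  obtain ⟨A, hA⟩ := exists_oracle_encoding
    (Sum.elim (fun p : OracleTM 2 × OracleTM 2 × ℕ × ℕ => postBPEWeights p.1 p.2.1 p.2.2.1 p.2.2.2)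
      fun p : OracleTM 3 × ℕ × ℕ × ℕ => maeWeights p.1 p.2.1 p.2.2.1 p.2.2.2)
  refine ⟨A, ?_, ?_⟩
  · rintro L ⟨M, N, c, d, hhalt, hpos, hyes, hno⟩
    have hweight : ∀ (n : ℕ) (x : Fin n → Bool),
        (postBPEWeights M N c d).weight n true x A = count (fun r : Fin (2 ^ (d * n)) → Bool =>
          M.Accepts (mlOracle A) ![List.ofFn x, List.ofFn r] ∧
          N.Accepts (mlOracle A) ![List.ofFn x, List.ofFn r]) ∧
        (postBPEWeights M N c d).weight n false x A = count (fun r : Fin (2 ^ (d * n)) → Bool =>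
          ¬ M.Accepts (mlOracle A) ![List.ofFn x, List.ofFn r] ∧
          N.Accepts (mlOracle A) ![List.ofFn x, List.ofFn r]) := by
      intro n x
      have h := hhalt (List.ofFn x)
      rw [List.length_ofFn] at h
      refine ⟨congrArg count (funext fun r => ?_), congrArg count (funext fun r => ?_)⟩
      · rw [(h r).1.accepts_iff, (h r).2.accepts_iff]
      · rw [(h r).1.not_accepts_iff, (h r).2.accepts_iff]
    refine mem_ioSIZELinear_of_encoded _ (hA (.inl (M, N, c, d))) (fun n x hx => ?_)
      fun n x hx => ?_
    · have h1 := hpos _ (.inl hx)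
      have h2 := hyes _ hx
      rw [List.length_ofFn] at h1 h2
      simp only [Sum.elim_inl, hweight]
      exact count_of_two_thirds_le_condProb h1 h2
    · have h1 := hpos _ (.inr hx)
      have h2 := hno _ hx
      rw [List.length_ofFn] at h1 h2
      simp only [Sum.elim_inl, hweight]
      exact count_of_condProb_le_one_third h1 h2
  · rintro L ⟨V, c, d, e, hhalt, hyes, hno⟩
    have hweight : ∀ (n : ℕ) (x : Fin n → Bool),
        (maeWeights V c d e).weight n true x A = 3 ^ (2 ^ (d * n) + 2) *
          ∑ u : Fin (2 ^ (d * n)) → Bool, count (fun r : Fin (2 ^ (e * n)) → Bool =>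
            V.Accepts (mlOracle A) ![List.ofFn x, List.ofFn u, List.ofFn r]) ^
              (2 ^ (d * n) + 2) := by
      intro n x
      have h := hhalt (List.ofFn x)
      rw [List.length_ofFn] at h
      simp only [(h _ _).accepts_iff]
      rfl
    have hfalse : ∀ (n : ℕ) (x : Fin n → Bool), (maeWeights V c d e).weight n false x A =
        2 ^ (2 ^ (d * n) + 1) * (2 ^ 2 ^ (e * n)) ^ (2 ^ (d * n) + 2) := fun _ _ => rfl
    refine mem_ioSIZELinear_of_encoded _ (hA (.inr (V, c, d, e))) (fun n x hx => ?_)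
      fun n x hx => ?_
    · have h1 := hyes _ hx
      rw [List.length_ofFn] at h1
      obtain ⟨u, hu⟩ := h1
      simp only [Sum.elim_inr, hweight, hfalse]
      have h2 := Nat.pow_le_pow_left (le_count_of_two_thirds_le_prob hu) (2 ^ (d * n) + 2)
      rw [mul_pow, mul_pow] at h2
      have h3 := h2.trans (Nat.mul_le_mul_left _ (Finset.single_le_sum
        (f := fun u : Fin (2 ^ (d * n)) → Bool => count (fun r : Fin (2 ^ (e * n)) → Bool =>
            V.Accepts (mlOracle A) ![List.ofFn x, List.ofFn u, List.ofFn r]) ^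
              (2 ^ (d * n) + 2)) (fun _ _ => Nat.zero_le _) (Finset.mem_univ u)))
      refine ⟨le_trans (le_of_eq (by ring)) h3, lt_of_lt_of_le (by positivity) h3⟩
    · have h1 := hno _ hx
      rw [List.length_ofFn] at h1
      simp only [Sum.elim_inr, hweight, hfalse]
      refine ⟨?_, by positivity⟩
      have h2 := fun u => Nat.pow_le_pow_left (count_le_of_prob_le_one_third (h1 u))
        (2 ^ (d * n) + 2)
      simp only [mul_pow] at h2
      have h3 := Finset.sum_le_sum fun u (_ : u ∈ Finset.univ) => h2 u
      rw [← Finset.mul_sum, Finset.sum_const, Finset.card_univ, Fintype.card_fun,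
        Fintype.card_bool, Fintype.card_fin, smul_eq_mul] at h3
      exact (Nat.mul_le_mul_left 2 h3).trans_eq (by ring)
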